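/- **Setting.** Let $d\ge 1$, $1\le\mu\le d$ and $\alpha,\gamma\in\mathbb R^d$ with $$\tfrac12<\alpha_1=\dots=\alpha_\mu<\alpha_{\mu+1}\le\dots\le\alpha_d,$$ $\gamma_s=\alpha_s$ for $s\le\mu$ and $\alpha_1<\gamma_s<\alpha_s$ for $s>\mu$. Let $\mathcal H^{\alpha}_{\rm mix}(\mathbb T^d)$ be the space of all $f\in L_2(\mathbb T^d)$ with $\|f|\mathcal H^{\alpha}_{\rm mix}\|^2=\sum_{k\in\mathbb Z^d}|\hat f_k|^2\prod_{s=1}^d(1+|k_s|^2)^{\alpha_s}<\infty$. Put $Q_0=\{-1,0,1\}$ and $Q_j=([-2^j,-2^{j-1}-1]\cup[2^{j-1}+1,2^j])\cap\mathbb Z$ for $j\ge1$. For real $R\ge1$ let $$H_R=H_R^{d,\gamma}=\bigcup\Big\{Q_{j_1}\times\dots\times Q_{j_d}:\ j\in\mathbb N_0^d,\ \tfrac1{\gamma_1}\,\gamma\cdot j\le R\Big\}$$ be the anisotropic hyperbolic cross, and let $\mathcal D(H_R)=\{h-h':h,h'\in H_R\}$. For $z\in\mathbb Z^d$ and $M\in\mathbb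 N$, $M\geq 1$, the sampling operator along the rank-1 lattice $\Lambda(z,M)=\{\frac jM z \bmod \mathbf 1: 0\le j<M\}$ is $$S_{H_R}^{\Lambda(z,M)}f=\sum_{k\in H_R}\Big(\frac1M\sum_{j=0}^{M-1}f\big(\tfrac jM z\big)e^{-2\pi i\frac jM k\cdot z}\Big)e^{2\pi i k\cdot\circ},$$ where the values of $f\in\mathcal H^{\alpha}_{\rm mix}(\mathbb T^d)$ are those of its continuous representative. The lattice is called *reconstructing* for $H_R$ if $S_{H_R}^{\Lambda(z,M)}p=p$ for all trigonometric polynomials $p$ with frequencies in $H_R$. A vector $z$ is *found by the component-by-component (CBC) search with lattice size $M$* if its components are chosen successively from $\{0,\dots,M-1\}$ such that, for every $s=1,\dots,d$, the residues modulo $M$ of $k_1z_1+\dots+k_sz_s$ are distinct for distinct elements $(k_1,\dots,k_s)$ of the projection of $H_R$ to the first $s$ coordinates. **Theorem.** 1. Every $f\in\mathcal H^{\alpha}_{\rm mix}(\mathbb T^d)$ has a continuous representative. 2. There is a constant $C>0$, depending only on $d,\mu,\alpha,\gamma$, such that for all real $R\ge1$ and every reconstructing rank-1 lattice $\Lambda(z,M)$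 for $H_R$ $$\big\|\mathrm{Id}-S_{H_R}^{\Lambda(z,M)}\,\big|\,\mathcal H^{\alpha}_{\rm mix}(\mathbb T^d)\to L_\infty(\mathbb T^d)\big\|\le C\,2^{-(\alpha_1-\frac12)R}R^{\frac{\mu-1}2}.$$ 3. For every real $R\ge1$ there is a prime $M\le|\mathcal D(H_R)|$ for which the CBC search succeeds in finding a vector $z$. 4. For every $\kappa\in\mathbb R$ there is a constant $C>0$, depending only on $d,\mu,\alpha,\gamma,\kappa$, such that for all real $R\ge1$, all $M$ with $M\le\kappa\,|\mathcal D(H_R)|$ and all $z$ found by the CBC search with lattice size $M$, the lattice $\Lambda(z,M)$ is a reconstructing lattice for $H_R$, $$2^{-(\alpha_1-\frac12)R}R^{\frac{\mu-1}2}\le C\,M^{-(\alpha_1-\frac12)/2}(\log M)^{(\mu-1)(\frac{\alpha_1}2+\frac14)}$$ and $$\big\|\mathrm{Id}-S_{H_R}^{\Lambda(z,M)}\,\big|\,\mathcal H^{\alpha}_{\rm mix}(\mathbb T^d)\to L_\infty(\mathbb T^d)\big\|\le C\,M^{-(\alpha_1-\frac12)/2}(\log M)^{(\mu-1)(\frac{\alpha_1}2+\frac14)}.$$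 -/

import Mathlib

open MeasureTheory
open scoped ENNReal

noncomputable section

namespace LatticeSampling

/-- The normalised Haar (Lebesgue) measure on the `d`-dimensional torus `(ℝ/ℤ)^d`. -/
def torusMeasure (d : ℕ) : Measure (UnitAddTorus (Fin d)) :=
  Measure.pi fun _ => AddCircle.haarAddCircle

/-- The norm of the Sobolev space of anisotropic mixed smoothness `α`,
`(∑_k |f̂_k|² ∏_s (1 + |k_s|²)^{α_s})^{1/2}`, with value `∞` when the series diverges. -/
def hmixNorm {d : ℕ} (α : Fin d → ℝ) (f : UnitAddTorus (Fin d) → ℂ) : ℝ≥0∞ :=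
  (∑' k : Fin d → ℤ, ENNReal.ofReal
    (‖UnitAddTorus.mFourierCoeff f k‖ ^ 2 * ∏ s, (1 + |(k s : ℝ)| ^ 2) ^ (α s))) ^ (1 / 2 : ℝ)

/-- The dyadic blocks `Q_0 = {-1,0,1}` and
`Q_j = ([-2^j, -2^{j-1}-1] ∪ [2^{j-1}+1, 2^j]) ∩ ℤ` for `j > 0`. -/
def dyadicBlock : ℕ → Set ℤ
  | 0 => {-1, 0, 1}
  | j + 1 => Set.Icc (-2 ^ (j + 1)) (-2 ^ j - 1) ∪ Set.Icc (2 ^ j + 1) (2 ^ (j + 1))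

/-- `J_R^{d,γ} = {j ∈ ℕ₀^d : (1/γ_1) γ·j ≤ R}`. The coordinates are indexed from `0`. -/
def levelSet {d : ℕ} [NeZero d] (γ : Fin d → ℝ) (R : ℝ) : Set (Fin d → ℕ) :=
  {j | (1 / γ 0) * ∑ s, γ s * (j s : ℝ) ≤ R}

/-- The anisotropic hyperbolic cross `H_R^{d,γ}`, the union of the boxes
`Q_{j_1} × ⋯ × Q_{j_d}` over `j ∈ J_R^{d,γ}`. -/
def hypCross {d : ℕ} [NeZero d] (γ : Fin d → ℝ) (R : ℝ) : Set (Fin d → ℤ) :=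
  ⋃ j ∈ levelSet γ R, Set.univ.pi fun s => dyadicBlock (j s)

/-- The difference set `{h - h' : h, h' ∈ I}`. -/
def differenceSet {d : ℕ} (I : Set (Fin d → ℤ)) : Set (Fin d → ℤ) :=
  Set.image2 (fun h h' => h - h') I I

/-- The node `(j / M) z mod 1` of the rank-1 lattice `Λ(z, M)`. -/
def latticeNode {d : ℕ} (z : Fin d → ℤ) (M j : ℕ) : UnitAddTorus (Fin d) :=
  fun s => (((j : ℝ) / M * z s : ℝ) : UnitAddCircle)

/-- The lattice rule `(1/M) ∑_{j<M} f((j/M) z) e^{-2πi (j/M) k·z}` for the `k`-th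
Fourier coefficient of `f`. -/
def latticeCoeff {d : ℕ} (z : Fin d → ℤ) (M : ℕ) (f : UnitAddTorus (Fin d) → ℂ)
    (k : Fin d → ℤ) : ℂ :=
  (1 / (M : ℂ)) * ∑ j ∈ Finset.range M,
    f (latticeNode z M j) * UnitAddTorus.mFourier (-k) (latticeNode z M j)

/-- The sampling operator `S_I^{Λ(z,M)} f = ∑_{k ∈ I} f̂_k^{Λ(z,M)} e^{2πi k·x}`, for a finite
set `I` of frequencies. -/
def latticeSampling {d : ℕ} (I : Set (Fin d → ℤ)) (z : Fin d → ℤ) (M : ℕ)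
    (f : UnitAddTorus (Fin d) → ℂ) (x : UnitAddTorus (Fin d)) : ℂ :=
  ∑ᶠ k ∈ I, latticeCoeff z M f k * UnitAddTorus.mFourier k x

/-- `Λ(z, M)` is a reconstructing rank-1 lattice for `I`: the sampling operator reproduces every
trigonometric polynomial with frequencies in `I`. -/
def IsReconstructing {d : ℕ} (I : Set (Fin d → ℤ)) (z : Fin d → ℤ) (M : ℕ) : Prop :=
  0 < M ∧ ∀ p ∈ Submodule.span ℂ
      ((fun k : Fin d → ℤ => (UnitAddTorus.mFourier k : C(UnitAddTorus (Fin d), ℂ))) '' I),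
    ∀ x, latticeSampling I z M p x = p x

/-- `z` is an outcome of the component-by-component search with lattice size `M` and frequency
set `I`: the components `z_1, …, z_d` are chosen one after the other from `{0, …, M-1}`, the
component `z_s` in such a way that the residues modulo `M` of `k_1 z_1 + ⋯ + k_s z_s` are
distinct for distinct elements `(k_1, …, k_s)` of the projection of `I` to the first `s`
coordinates. -/
structure IsCBCVector {d : ℕ} (I : Set (Fin d → ℤ)) (z : Fin d → ℤ) (M : ℕ) : Prop where
  range : ∀ s, 0 ≤ z s ∧ z s < M
  step : ∀ s : Fin d, ∀ k ∈ I, ∀ k' ∈ I,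
    (∑ t ∈ Finset.Iic s, k t * z t) ≡ (∑ t ∈ Finset.Iic s, k' t * z t) [ZMOD M] →
      ∀ t ≤ s, k t = k' t

/-- The operator norm of `Id - S_I^{Λ(z,M)}` from the Sobolev space of anisotropic mixed
smoothness `α` to `L_∞`. Functions are represented by their continuous representatives. -/
def samplingErrorNorm {d : ℕ} (α : Fin d → ℝ) (I : Set (Fin d → ℤ)) (z : Fin d → ℤ) (M : ℕ) :
    ℝ≥0∞ :=
  ⨆ (f : C(UnitAddTorus (Fin d), ℂ)) (_ : hmixNorm α f ≤ 1),
    eLpNorm (fun x => f x - latticeSampling I z M f x) ∞ (torusMeasure d)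

theorem finite_dyadicBlock (j : ℕ) : (dyadicBlock j).Finite := by
  cases j with
  | zero =>
    change ({-1, 0, 1} : Set ℤ).Finite
    exact Set.toFinite _
  | succ j => exact (Set.finite_Icc _ _).union (Set.finite_Icc _ _)

/-- For positive weights the hyperbolic cross is finite, so that the sums over it are genuine. -/
theorem finite_hypCross {d : ℕ} [NeZero d] (γ : Fin d → ℝ) (hγ : ∀ s, 0 < γ s) (R : ℝ) :
    (hypCross γ R).Finite := by
  have hJ : (levelSet γ R).Finite := by
    refine (Set.Finite.pi (t := fun s : Fin d => Set.Iic ⌊R * γ 0 / γ s⌋₊)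
      fun s => Set.finite_Iic _).subset ?_
    intro j hj s _
    have h1 : γ s * (j s : ℝ) ≤ ∑ t, γ t * (j t : ℝ) :=
      Finset.single_le_sum (f := fun t => γ t * (j t : ℝ))
        (fun t _ => mul_nonneg (hγ t).le (Nat.cast_nonneg _)) (Finset.mem_univ s)
    have h2 : (∑ t, γ t * (j t : ℝ)) ≤ R * γ 0 := by
      have h3 : (1 / γ 0) * ∑ t, γ t * (j t : ℝ) ≤ R := hj
      rw [one_div, inv_mul_le_iff₀ (hγ 0)] at h3
      linarith
    apply Nat.le_floor
    rw [le_div_iff₀ (hγ s)]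
    linarith
  exact hJ.biUnion fun j _ => Set.Finite.pi fun s => finite_dyadicBlock (j s)

end LatticeSampling

end

namespace LatticeSampling

/-! Error bound. A reconstructing lattice gives distinct elements of the cross distinct residues `k
· z` mod `M`, so every frequency `h` has at most one alias in the cross, and `h` itself is that
alias if `h` lies in it. Hence sampling errs only on frequencies outside, each contributing at most
`2|f̂_h|` (`enorm_sub_latticeSampling_le`). Cauchy–Schwarz reduces the error to the tail sum of `∏
(1 + k_s²)^{-α_s}` (`samplingErrorNorm_le`).

That tail and the size of the cross are estimated in the same way. Summing over the first coordinate
turns the cross condition into an exponential in the remaining levels, so the rest factors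
(`tsum_cross_le`). Perturbing the exponent by `δ` of order `1/R` costs only a constant, and makes
each of the other `μ - 1` critical coordinates a geometric series of size about `1/δ`, that is, of
order `R`. The noncritical coordinates have a fixed gap and contribute constants.

Search. A difference with positive coordinate `s` forbids one residue for `z_s`. By symmetry fewer
than half of the differences count, so a prime of at least half the size of the difference set,
given by Bertrand's postulate, suffices.

Rate in `M`. The difference set lies in a cross of parameter `2R + O(1)`, so `M` is at most of order
`2^{2R} R^{μ-1}`, while an axis of the cross forces `M ≥ 2^R`, whence `log M ≥ R log 2`.
Substitution gives the final bound (`rate_le_of_size_le`). -/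

/-! ### Dyadic levels and the hyperbolic cross -/

/-- The index of the dyadic block containing `n`. -/
def dyadicLevel (n : ℤ) : ℕ := Nat.clog 2 n.natAbs

theorem dyadicLevel_le_iff {n : ℤ} {j : ℕ} : dyadicLevel n ≤ j ↔ n.natAbs ≤ 2 ^ j :=
  Nat.clog_le_iff_le_pow one_lt_two

theorem mem_dyadicBlock_iff {n : ℤ} {j : ℕ} : n ∈ dyadicBlock j ↔ dyadicLevel n = j := by
  cases j with
  | zero =>
    rw [← Nat.le_zero, dyadicLevel_le_iff]
    change n = -1 ∨ n = 0 ∨ n = 1 ↔ _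
    omega
  | succ j =>
    have h1 := dyadicLevel_le_iff (n := n) (j := j)
    have h2 := dyadicLevel_le_iff (n := n) (j := j + 1)
    have : dyadicLevel n = j + 1 ↔ n.natAbs ≤ 2 ^ (j + 1) ∧ ¬ n.natAbs ≤ 2 ^ j := by
      rw [← h1, ← h2]; omega
    rw [this]
    change (-2 ^ (j + 1) ≤ n ∧ n ≤ -2 ^ j - 1) ∨ (2 ^ j + 1 ≤ n ∧ n ≤ 2 ^ (j + 1)) ↔ _
    have e1 : ((2 ^ j : ℕ) : ℤ) = 2 ^ j := by push_cast; rfl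
    have e2 : ((2 ^ (j + 1) : ℕ) : ℤ) = 2 ^ (j + 1) := by push_cast; rfl
    rw [← e1, ← e2]
    omega

/-- The weighted level `(1/γ_1) ∑ γ_s j_s` of the block containing `k`. -/
noncomputable def crossLevel {d : ℕ} [NeZero d] (γ : Fin d → ℝ) (k : Fin d → ℤ) : ℝ :=
  (1 / γ 0) * ∑ s, γ s * (dyadicLevel (k s) : ℝ)

/-- The blocks partition `ℤ`, so `k` lies in exactly one box and the union becomes a single
inequality. -/
theorem mem_hypCross_iff {d : ℕ} [NeZero d] {γ : Fin d → ℝ} {R : ℝ} {k : Fin d → ℤ} :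
    k ∈ hypCross γ R ↔ crossLevel γ k ≤ R := by
  simp only [hypCross, Set.mem_iUnion, Set.mem_univ_pi, mem_dyadicBlock_iff]
  constructor
  · rintro ⟨j, hj, h⟩
    obtain rfl : (fun s => dyadicLevel (k s)) = j := funext h
    exact hj
  · intro h
    exact ⟨fun s => dyadicLevel (k s), h, fun _ => rfl⟩

theorem crossLevel_succ {n : ℕ} (γ : Fin (n + 1) → ℝ) (h0 : γ 0 ≠ 0) (k : Fin (n + 1) → ℤ) :
    crossLevel γ k = dyadicLevel (k 0) +
      ∑ s : Fin n, γ s.succ / γ 0 * (dyadicLevel (k s.succ) : ℝ) := by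
  rw [crossLevel, Fin.sum_univ_succ, mul_add, Finset.mul_sum]
  congr 1
  · field_simp
  · refine Finset.sum_congr rfl fun s _ => ?_
    ring

theorem encard_dyadicLevel_le (j : ℕ) :
    ({n : ℤ | dyadicLevel n ≤ j}.encard : ℝ≥0∞) ≤ 3 * 2 ^ j := by
  have h : {n : ℤ | dyadicLevel n ≤ j} = (Finset.Icc (-(2 ^ j : ℕ) : ℤ) (2 ^ j : ℕ) : Set ℤ) := by
    ext n
    simp only [Set.mem_ofPred_eq, dyadicLevel_le_iff, Finset.coe_Icc, Set.mem_Icc]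
    omega
  rw [h, Set.encard_coe_eq_coe_finsetCard, Int.card_Icc]
  have h2 : ((2 ^ j : ℕ) + 1 - (-(2 ^ j : ℕ)) : ℤ).toNat ≤ 3 * 2 ^ j := by
    have : 1 ≤ 2 ^ j := Nat.one_le_two_pow
    generalize 2 ^ j = x at *
    omega
  have h3 : ((((2 ^ j : ℕ) + 1 - (-(2 ^ j : ℕ)) : ℤ).toNat : ℕ) : ℝ≥0∞)
      ≤ ((3 * 2 ^ j : ℕ) : ℝ≥0∞) := Nat.cast_le.mpr h2
  simpa using h3

/-! ### Level sums and their factorisation -/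

/-- A sum over `ℤ` of a function of the dyadic level. -/
theorem tsum_dyadicLevel_le (g : ℕ → ℝ≥0∞) :
    ∑' n : ℤ, g (dyadicLevel n) ≤ ∑' j : ℕ, 3 * 2 ^ j * g j := by
  rw [← ENNReal.tsum_fiberwise (fun n : ℤ => g (dyadicLevel n)) dyadicLevel]
  refine ENNReal.tsum_le_tsum fun j => ?_
  have h : ∀ b : dyadicLevel ⁻¹' {j}, g (dyadicLevel b) = g j := fun b => congrArg g b.2
  simp_rw [h]
  rw [ENNReal.tsum_const, ENat.card_coe_set_eq]
  gcongr
  refine le_trans ?_ (encard_dyadicLevel_le j)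
  have : (dyadicLevel ⁻¹' {j}).encard ≤ {n : ℤ | dyadicLevel n ≤ j}.encard :=
    Set.encard_le_encard fun n hn => le_of_eq hn
  exact_mod_cast this

/-- The sum of a product function over `κ ^ n` is the product of the sums. -/
theorem tsum_pi_prod {κ : Type*} (n : ℕ) (f : Fin n → κ → ℝ≥0∞) :
    ∑' k : Fin n → κ, ∏ s, f s (k s) = ∏ s, ∑' m, f s m := by
  induction n with
  | zero => simp
  | succ n ih =>
    rw [← (Fin.consEquiv fun _ : Fin (n + 1) => κ).tsum_eq, ENNReal.tsum_prod', Fin.prod_univ_succ,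
      ← ih]
    simp [Fin.consEquiv, Fin.prod_univ_succ, ENNReal.tsum_mul_left, ENNReal.tsum_mul_right]

theorem two_rpow_add (x y : ℝ) : (2 : ℝ≥0∞) ^ (x + y) = 2 ^ x * 2 ^ y :=
  ENNReal.rpow_add _ _ two_ne_zero (by simp)

theorem two_rpow_sum {ι : Type*} (s : Finset ι) (f : ι → ℝ) :
    (2 : ℝ≥0∞) ^ (∑ i ∈ s, f i) = ∏ i ∈ s, (2 : ℝ≥0∞) ^ f i := by
  classical
  induction s using Finset.induction_on with
  | empty => simp
  | insert a s ha ih => rw [Finset.sum_insert ha, Finset.prod_insert ha, two_rpow_add, ih]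

theorem two_rpow_mono {x y : ℝ} (h : x ≤ y) : (2 : ℝ≥0∞) ^ x ≤ 2 ^ y :=
  ENNReal.rpow_le_rpow_of_exponent_le (by norm_num) h

theorem two_rpow_eq_ofReal (x : ℝ) : (2 : ℝ≥0∞) ^ x = ENNReal.ofReal (2 ^ x) := by
  rw [← ENNReal.ofReal_rpow_of_pos two_pos]; simp

/-- A geometric series whose ratio may be close to `1`. -/
theorem tsum_two_rpow_neg_le {η δ : ℝ} (hδ : 0 < δ) (hδ1 : δ ≤ 1) (hη : δ ≤ η) :
    ∑' j : ℕ, (2 : ℝ≥0∞) ^ (-η * j) ≤ ENNReal.ofReal (2 / δ) := by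
  have h1 : ∀ j : ℕ, (2 : ℝ≥0∞) ^ (-η * j) ≤ (ENNReal.ofReal (1 - δ / 2)) ^ j := by
    intro j
    rw [ENNReal.rpow_mul, ENNReal.rpow_natCast]
    gcongr
    rw [two_rpow_eq_ofReal]
    apply ENNReal.ofReal_le_ofReal
    -- Bernoulli's inequality: `2^{-δ} = (1 - 1/2)^δ ≤ 1 - δ/2`.
    have hB := rpow_one_add_le_one_add_mul_self (s := -(1 / 2)) (by norm_num) hδ.le hδ1
    calc (2 : ℝ) ^ (-η) ≤ 2 ^ (-δ) := Real.rpow_le_rpow_of_exponent_le (by norm_num) (by linarith)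
      _ = (1 + -(1 / 2)) ^ δ := by
        rw [Real.rpow_neg two_pos.le, ← Real.inv_rpow two_pos.le]; norm_num
      _ ≤ _ := by linarith
  refine (ENNReal.tsum_le_tsum h1).trans ?_
  rw [ENNReal.tsum_geometric, ← ENNReal.ofReal_one, ← ENNReal.ofReal_sub _ (by linarith),
    ← ENNReal.ofReal_inv_of_pos (by linarith)]
  apply ENNReal.ofReal_le_ofReal
  rw [sub_sub_cancel, inv_div]

/-- Summation over the first coordinate reduces a sum over a hyperbolic cross, or over its
complement, to a product of one-dimensional sums. -/
theorem tsum_cross_le {n : ℕ} (w : Fin n → ℝ) (u : Fin n → ℤ → ℝ≥0∞) (E : ℤ → ℝ → ℝ≥0∞)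
    (A : ℝ≥0∞) (c T : ℝ) (hE : ∀ t, ∑' m, E m t ≤ A * 2 ^ (c * t)) :
    ∑' k : Fin (n + 1) → ℤ, E (k 0) (T - ∑ s, w s * (dyadicLevel (k s.succ) : ℝ)) *
        ∏ s, u s (k s.succ) ≤
      A * 2 ^ (c * T) * ∏ s, ∑' m : ℤ, u s m * 2 ^ (-(c * w s) * (dyadicLevel m : ℝ)) := by
  rw [← (Fin.consEquiv fun _ : Fin (n + 1) => ℤ).tsum_eq, ENNReal.tsum_prod', ENNReal.tsum_comm,
    ← tsum_pi_prod, ← ENNReal.tsum_mul_left]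
  refine ENNReal.tsum_le_tsum fun k => ?_
  simp only [Fin.consEquiv, Equiv.coe_fn_mk, Fin.cons_zero, Fin.cons_succ]
  rw [ENNReal.tsum_mul_right, Finset.prod_mul_distrib, ← two_rpow_sum]
  -- The threshold is affine in the other levels, so `2^{c t}` splits into one factor per
  -- coordinate.
  refine (mul_le_mul_left (hE _) _).trans (le_of_eq ?_)
  rw [mul_sub, sub_eq_add_neg, two_rpow_add, Finset.mul_sum, ← Finset.sum_neg_distrib]
  simp only [neg_mul, mul_assoc]
  ring

/-- The product of the one-dimensional sums in `tsum_cross_le`. -/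
theorem prod_tsum_le {n μ : ℕ} (hμ : 1 ≤ μ) {B : ℝ} (hB : 1 ≤ B) {ε : ℝ} (hε : 0 < ε) (hε1 : ε ≤ 1)
    {δ : ℝ} (hδ : 0 < δ) (hδ1 : δ ≤ 1) (β : Fin n → ℝ) (v : Fin n → ℤ → ℝ≥0∞)
    (hv : ∀ s m, v s m ≤ ENNReal.ofReal B * 2 ^ (-(1 + β s) * (dyadicLevel m : ℝ)))
    (hβ : ∀ s, δ ≤ β s) (hβ' : ∀ s : Fin n, μ ≤ (s : ℕ) + 1 → ε ≤ β s) :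
    ∏ s, ∑' m : ℤ, v s m ≤ ENNReal.ofReal ((6 * B / ε) ^ n * (1 / δ) ^ (μ - 1)) := by
  have key : ∀ s (η : ℝ), 0 < η → η ≤ 1 → η ≤ β s →
      ∑' m : ℤ, v s m ≤ ENNReal.ofReal (6 * B / η) := by
    intro s η h0 h1 h2
    calc ∑' m : ℤ, v s m
        ≤ ∑' m : ℤ, ENNReal.ofReal B * 2 ^ (-(1 + β s) * (dyadicLevel m : ℝ)) :=
          ENNReal.tsum_le_tsum (hv s)
      _ ≤ ∑' j : ℕ, 3 * 2 ^ j * (ENNReal.ofReal B * 2 ^ (-(1 + β s) * (j : ℝ))) :=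
          tsum_dyadicLevel_le fun j => ENNReal.ofReal B * 2 ^ (-(1 + β s) * (j : ℝ))
      _ = 3 * ENNReal.ofReal B * ∑' j : ℕ, (2 : ℝ≥0∞) ^ (-(β s) * (j : ℝ)) := by
          rw [← ENNReal.tsum_mul_left]
          refine tsum_congr fun j => ?_
          have : -(1 + β s) * (j : ℝ) = -(j : ℝ) + -(β s) * (j : ℝ) := by ring
          rw [this, two_rpow_add, ENNReal.rpow_neg, ENNReal.rpow_natCast]
          have h3 : (2 : ℝ≥0∞) ^ j * (2 ^ j)⁻¹ = 1 :=
            ENNReal.mul_inv_cancel (by simp) (by simp)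
          calc _ = 3 * ENNReal.ofReal B * ((2 : ℝ≥0∞) ^ j * (2 ^ j)⁻¹) *
                (2 : ℝ≥0∞) ^ (-(β s) * (j : ℝ)) := by ring
            _ = _ := by rw [h3, mul_one]
      _ ≤ 3 * ENNReal.ofReal B * ENNReal.ofReal (2 / η) := by
          gcongr
          exact tsum_two_rpow_neg_le h0 h1 h2
      _ = ENNReal.ofReal (6 * B / η) := by
          rw [show (3 : ℝ≥0∞) = ENNReal.ofReal 3 by simp, ← ENNReal.ofReal_mul (by norm_num),
            ← ENNReal.ofReal_mul (by positivity)]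
          congr 1
          ring
  -- Here `s` stands for the coordinate `s + 1`, the first having been summed out; so at most `μ -
  -- 1` factors carry `1/δ`.
  have h1 : ∀ s : Fin n, ∑' m : ℤ, v s m ≤
      ENNReal.ofReal (6 * B / ε * if (s : ℕ) + 1 < μ then 1 / δ else 1) := by
    intro s
    split_ifs with h
    · refine (key s δ hδ hδ1 (hβ s)).trans (ENNReal.ofReal_le_ofReal ?_)
      rw [mul_one_div]
      gcongr
      rw [le_div_iff₀ hε]
      nlinarith
    · rw [mul_one]
      exact key s ε hε hε1 (hβ' s (not_lt.mp h))
  refine (Finset.prod_le_prod' fun s _ => h1 s).trans ?_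
  rw [← ENNReal.ofReal_prod_of_nonneg fun s _ => by positivity]
  apply ENNReal.ofReal_le_ofReal
  rw [Finset.prod_mul_distrib, Finset.prod_const, Finset.card_univ, Fintype.card_fin]
  gcongr
  rw [Finset.prod_ite, Finset.prod_const, Finset.prod_const_one, mul_one]
  refine pow_le_pow_right₀ (by rw [le_div_iff₀ hδ]; linarith) ?_
  calc _ = ((Finset.univ.filter fun s : Fin n => (s : ℕ) + 1 < μ).map Fin.valEmbedding).card :=
        (Finset.card_map _).symm
    _ ≤ (Finset.range (μ - 1)).card := by
        apply Finset.card_le_card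
        intro x hx
        simp only [Finset.mem_map, Finset.mem_filter, Finset.mem_univ, true_and,
          Fin.valEmbedding_apply] at hx
        obtain ⟨s, hs, rfl⟩ := hx
        simp only [Finset.mem_range]
        omega
    _ = μ - 1 := Finset.card_range _

/-- The number of integers of level at most `t`. -/
theorem tsum_dyadicLevel_le_ite {δ : ℝ} (hδ : 0 ≤ δ) (t : ℝ) :
    ∑' m : ℤ, (if (dyadicLevel m : ℝ) ≤ t then (1 : ℝ≥0∞) else 0) ≤ 3 * 2 ^ ((1 + δ) * t) := by
  rcases lt_or_ge t 0 with ht | ht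
  · have : ∀ m : ℤ, ¬ (dyadicLevel m : ℝ) ≤ t := fun m => by
      have := Nat.cast_nonneg (α := ℝ) (dyadicLevel m)
      linarith
    simp [this]
  · have h1 : ∀ m : ℤ, (if (dyadicLevel m : ℝ) ≤ t then (1 : ℝ≥0∞) else 0) =
        {n : ℤ | dyadicLevel n ≤ ⌊t⌋₊}.indicator 1 m := by
      intro m
      simp [Set.indicator_apply, Nat.le_floor_iff ht]
    simp_rw [h1]
    rw [← tsum_subtype]
    simp only [Pi.one_apply, ENNReal.tsum_const, ENat.card_coe_set_eq, mul_one]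
    refine (encard_dyadicLevel_le _).trans ?_
    gcongr
    rw [← ENNReal.rpow_natCast]
    apply two_rpow_mono
    have := Nat.floor_le ht
    nlinarith

/-- The mass of the integers of level larger than `t`. -/
theorem tsum_dyadicLevel_gt_ite {a B δ η : ℝ} (hη : 0 < η) (hη1 : η ≤ 1) (hηa : η ≤ a)
    (hδ : 0 ≤ δ) (hδa : δ ≤ a) (u : ℤ → ℝ≥0∞)
    (hu : ∀ m, u m ≤ ENNReal.ofReal B * 2 ^ (-(1 + a) * (dyadicLevel m : ℝ))) (t : ℝ) :
    ∑' m : ℤ, (if t < (dyadicLevel m : ℝ) then u m else 0) ≤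
      3 * ENNReal.ofReal B * ENNReal.ofReal (2 / η) * 2 ^ (-(a - δ) * t) := by
  -- For negative `t` the ceiling is `0`. The bound persists for every real `t` since `a - δ ≥ 0`
  -- and `t ≤ N`, which matters because the threshold in `tsum_cross_le` may be negative.
  set N := ⌈t⌉₊ with hN
  have h1 : ∀ m : ℤ, (if t < (dyadicLevel m : ℝ) then u m else 0) ≤
      (fun j : ℕ => if N ≤ j then ENNReal.ofReal B * (2 : ℝ≥0∞) ^ (-(1 + a) * (j : ℝ)) else 0)
        (dyadicLevel m) := by
    intro m
    dsimp only
    split_ifs with h h' h'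
    · exact hu m
    · exact absurd (Nat.ceil_le.mpr h.le) h'
    · exact zero_le
    · exact le_rfl
  refine (ENNReal.tsum_le_tsum h1).trans ((tsum_dyadicLevel_le
    fun j : ℕ => if N ≤ j then ENNReal.ofReal B * (2 : ℝ≥0∞) ^ (-(1 + a) * (j : ℝ)) else 0).trans ?_)
  have h2 : ∀ j : ℕ, 3 * (2 : ℝ≥0∞) ^ j *
      (if N ≤ j then ENNReal.ofReal B * (2 : ℝ≥0∞) ^ (-(1 + a) * (j : ℝ)) else 0) ≤
      3 * ENNReal.ofReal B * (if N ≤ j then (2 : ℝ≥0∞) ^ (-a * (j : ℝ)) else 0) := by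
    intro j
    split_ifs with h
    · apply le_of_eq
      have : -(1 + a) * (j : ℝ) = -(j : ℝ) + -a * (j : ℝ) := by ring
      rw [this, two_rpow_add, ENNReal.rpow_neg, ENNReal.rpow_natCast]
      have h3 : (2 : ℝ≥0∞) ^ j * (2 ^ j)⁻¹ = 1 := ENNReal.mul_inv_cancel (by simp) (by simp)
      calc _ = 3 * ENNReal.ofReal B * ((2 : ℝ≥0∞) ^ j * (2 ^ j)⁻¹) *
            (2 : ℝ≥0∞) ^ (-a * (j : ℝ)) := by ring
        _ = _ := by rw [h3, mul_one]
    · simp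
  refine (ENNReal.tsum_le_tsum h2).trans ?_
  rw [ENNReal.tsum_mul_left, mul_assoc (3 * ENNReal.ofReal B)]
  gcongr
  have h3 : ∑' j : ℕ, (if N ≤ j then (2 : ℝ≥0∞) ^ (-a * (j : ℝ)) else 0) =
      ∑' i : ℕ, (2 : ℝ≥0∞) ^ (-a * ((i + N : ℕ) : ℝ)) := by
    rw [← ENNReal.summable.sum_add_tsum_nat_add' (k := N)]
    rw [Finset.sum_eq_zero, zero_add]
    · simp
    · intro i hi
      rw [if_neg]
      simpa using hi
  rw [h3]
  have h4 : ∀ i : ℕ, (2 : ℝ≥0∞) ^ (-a * ((i + N : ℕ) : ℝ)) =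
      2 ^ (-a * (i : ℝ)) * 2 ^ (-a * (N : ℝ)) := by
    intro i
    rw [← two_rpow_add]
    push_cast
    ring_nf
  simp_rw [h4]
  rw [ENNReal.tsum_mul_right]
  refine mul_le_mul' (tsum_two_rpow_neg_le hη hη1 hηa) (two_rpow_mono ?_)
  · have := Nat.le_ceil t
    have h5 : (0 : ℝ) ≤ N := Nat.cast_nonneg _
    nlinarith

/-! ### The Sobolev weights, their tail, and the size of the cross -/

/-- The factor `(1 + m²)^{-a}` as an extended nonnegative real. -/
noncomputable def decay (a : ℝ) (m : ℤ) : ℝ≥0∞ := ENNReal.ofReal ((1 + |(m : ℝ)| ^ 2) ^ (-a))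

/-- At positive level `|m|` exceeds half of `2 ^ dyadicLevel m`, hence the factor `4`. -/
theorem two_pow_dyadicLevel_le (m : ℤ) :
    (2 : ℝ) ^ (2 * (dyadicLevel m : ℝ)) ≤ 4 * (1 + |(m : ℝ)| ^ 2) := by
  have h : (2 : ℝ) ^ dyadicLevel m ≤ max 1 (2 * |(m : ℝ)|) := by
    rcases Nat.eq_zero_or_pos (dyadicLevel m) with h0 | h0
    · simp [h0]
    · obtain ⟨j, hj⟩ := Nat.exists_eq_succ_of_ne_zero h0.ne'
      have h1 : ¬ dyadicLevel m ≤ j := by omega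
      rw [dyadicLevel_le_iff, not_le] at h1
      have h2 : (2 : ℝ) ^ j < |(m : ℝ)| := by
        have : ((2 ^ j : ℕ) : ℝ) < (m.natAbs : ℝ) := Nat.cast_lt.mpr h1
        rw [Nat.cast_natAbs] at this
        push_cast at this
        exact this
      rw [hj, Nat.succ_eq_add_one, pow_succ]
      exact le_max_of_le_right (by linarith)
  have h0 : (2 : ℝ) ^ (2 * (dyadicLevel m : ℝ)) = (2 ^ dyadicLevel m) ^ 2 := by
    rw [mul_comm, Real.rpow_mul two_pos.le, Real.rpow_natCast]
    norm_num
  rw [h0]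
  have hp : (0 : ℝ) < 2 ^ dyadicLevel m := by positivity
  have ha := abs_nonneg (m : ℝ)
  rcases le_max_iff.mp h with h | h <;> nlinarith

theorem decay_le {a B : ℝ} (ha : 0 ≤ a) (hB : 4 ^ a ≤ B) (m : ℤ) :
    decay a m ≤ ENNReal.ofReal B * 2 ^ (-(2 * a) * (dyadicLevel m : ℝ)) := by
  rw [two_rpow_eq_ofReal, ← ENNReal.ofReal_mul (le_trans (by positivity) hB)]
  apply ENNReal.ofReal_le_ofReal
  have h := two_pow_dyadicLevel_le m
  have h1 : (4 : ℝ) ^ (-a) * (1 + |(m : ℝ)| ^ 2) ^ (-a) ≤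
      (2 : ℝ) ^ (-(2 * a) * (dyadicLevel m : ℝ)) := by
    rw [← Real.mul_rpow (by norm_num) (by positivity)]
    calc _ ≤ ((2 : ℝ) ^ (2 * (dyadicLevel m : ℝ))) ^ (-a) :=
          Real.rpow_le_rpow_of_nonpos (by positivity) h (by linarith)
      _ = _ := by
          rw [← Real.rpow_mul two_pos.le]
          ring_nf
  calc (1 + |(m : ℝ)| ^ 2) ^ (-a) = 4 ^ a * (4 ^ (-a) * (1 + |(m : ℝ)| ^ 2) ^ (-a)) := by
        rw [← mul_assoc, ← Real.rpow_add (by norm_num)]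
        simp
    _ ≤ B * 2 ^ (-(2 * a) * (dyadicLevel m : ℝ)) :=
        mul_le_mul hB h1 (by positivity) (le_trans (by positivity) hB)

theorem tsum_decay_ne_top {a : ℝ} (ha : 1 / 2 < a) : ∑' m, decay a m ≠ ∞ := by
  set η := min (2 * a - 1) 1
  have hη : 0 < η := lt_min (by linarith) one_pos
  -- The threshold `-1` lies below every level, so the tail is the whole sum.
  have h := tsum_dyadicLevel_gt_ite (a := 2 * a - 1) (B := 4 ^ a) (δ := 0) hη (min_le_right _ _)
    (min_le_left _ _) le_rfl (by linarith) (decay a)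
    (fun m => (decay_le (by linarith) le_rfl m).trans_eq (by ring_nf)) (-1)
  have h1 : ∀ m : ℤ, (if (-1 : ℝ) < (dyadicLevel m : ℝ) then decay a m else 0) = decay a m := by
    intro m
    rw [if_pos]
    have : (0 : ℝ) ≤ dyadicLevel m := Nat.cast_nonneg _
    linarith
  simp_rw [h1] at h
  refine ne_top_of_le_ne_top ?_ h
  rw [two_rpow_eq_ofReal]
  finiteness

theorem tsum_prod_decay_ne_top {d : ℕ} {α : Fin d → ℝ} (hα : ∀ s, 1 / 2 < α s) :
    ∑' k : Fin d → ℤ, ∏ s, decay (α s) (k s) ≠ ∞ := by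
  rw [tsum_pi_prod]
  exact ENNReal.prod_ne_top fun s _ => tsum_decay_ne_top (hα s)

theorem exists_uniform_pos {n : ℕ} (p : Fin n → Prop) (g : Fin n → ℝ) (hg : ∀ s, p s → 0 < g s) :
    ∃ ε, 0 < ε ∧ ε ≤ 1 ∧ ∀ s, p s → ε ≤ g s := by
  classical
  by_cases hn : (Finset.univ.filter p).Nonempty
  · obtain ⟨s, hs, h⟩ := Finset.exists_min_image _ g hn
    refine ⟨min (g s) 1, lt_min (hg s (by simpa using hs)) one_pos, min_le_right _ _,
      fun t ht => (min_le_left _ _).trans (h t (by simpa using ht))⟩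
  · refine ⟨1, one_pos, le_rfl, fun s hs => absurd ⟨s, by simpa using hs⟩ hn⟩

/-- The mass of the weights outside of the hyperbolic cross. -/
theorem exists_tsum_decay_tail_le {d : ℕ} [NeZero d] {μ : ℕ} (hμ : 1 ≤ μ) {α γ : Fin d → ℝ}
    (hα : 1 / 2 < α 0) (hα_mono : Monotone α)
    (hα_eq : ∀ s : Fin d, (s : ℕ) < μ → α s = α 0)
    (hγ_eq : ∀ s : Fin d, (s : ℕ) < μ → γ s = α s)
    (hγ_lt : ∀ s : Fin d, μ ≤ (s : ℕ) → α 0 < γ s ∧ γ s < α s) :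
    ∃ C : ℝ, 0 < C ∧ ∀ R : ℝ, 1 ≤ R →
      ∑' k : Fin d → ℤ, (if R < crossLevel γ k then ∏ s, decay (α s) (k s) else 0) ≤
        ENNReal.ofReal (C * (2 ^ (-(2 * α 0 - 1) * R) * R ^ (μ - 1))) := by
  obtain ⟨n, rfl⟩ : ∃ n, d = n + 1 := Nat.exists_eq_succ_of_ne_zero (NeZero.ne d)
  have hγ0 : γ 0 = α 0 := hγ_eq 0 hμ
  have hw : ∀ s, 1 ≤ γ s / γ 0 := by
    intro s
    rw [one_le_div (by rw [hγ0]; linarith)]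
    rcases lt_or_ge (s : ℕ) μ with h | h
    · rw [hγ_eq s h, hα_eq s h, hγ0]
    · rw [hγ0]; exact (hγ_lt s h).1.le
  set a := 2 * α 0 - 1 with ha
  have ha0 : 0 < a := by linarith
  -- Critical coordinates decay exactly as fast as the first-coordinate sum grows; this is the
  -- source of the power of `R`. Elsewhere `α 0 < γ s < α s` leaves a strict gap.
  have hgap : ∀ s : Fin (n + 1), (s : ℕ) < μ → 2 * α s - 1 - a * (γ s / γ 0) = 0 := by
    intro s hs
    rw [hγ_eq s hs, hα_eq s hs, hγ0, div_self (by linarith)]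
    ring
  have hgap' : ∀ s : Fin (n + 1), μ ≤ (s : ℕ) → 0 < 2 * α s - 1 - a * (γ s / γ 0) := by
    intro s hs
    obtain ⟨h1, h2⟩ := hγ_lt s hs
    rw [hγ0, mul_div_assoc', sub_pos, div_lt_iff₀ (by linarith), ha]
    nlinarith
  obtain ⟨ε, hε, hε1, hεs⟩ := exists_uniform_pos (fun s : Fin (n + 1) => μ ≤ (s : ℕ)) _ hgap'
  set B : ℝ := 4 ^ α (Fin.last n) with hBdef
  have hαpos : ∀ s, 0 ≤ α s := fun s => by
    have := hα_mono (Fin.zero_le s); linarith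
  have hB : ∀ s, (4 : ℝ) ^ α s ≤ B := fun s =>
    Real.rpow_le_rpow_of_exponent_le (by norm_num) (hα_mono (Fin.le_last s))
  have hB1 : 1 ≤ B := Real.one_le_rpow (by norm_num) (hαpos _)
  set η := min a 1
  have hη : 0 < η := lt_min ha0 one_pos
  have hηa : η ≤ a := min_le_left _ _
  have hη1 : η ≤ 1 := min_le_right _ _
  refine ⟨6 * B / η * 2 ^ η * ((6 * B / ε) ^ n * (1 / η) ^ (μ - 1)), by positivity, fun R hR => ?_⟩
  -- With this choice `2^{δR} = 2^η` is a constant, while `1/δ` is proportional to `R`.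
  set δ := η / R with hδdef
  have hδ : 0 < δ := by positivity
  have hδη : δ ≤ η := div_le_self hη.le hR
  have hcross := tsum_cross_le (fun s : Fin n => γ s.succ / γ 0) (fun s => decay (α s.succ))
    (fun m t => if t < (dyadicLevel m : ℝ) then decay (α 0) m else 0)
    (3 * ENNReal.ofReal B * ENNReal.ofReal (2 / η)) (-(a - δ)) R
    (fun t => tsum_dyadicLevel_gt_ite hη hη1 hηa hδ.le (hδη.trans hηa) _
      (fun m => (decay_le (hαpos 0) (hB 0) m).trans_eq (by rw [ha]; ring_nf)) t)
  have hprod := prod_tsum_le (n := n) hμ hB1 hε hε1 hδ (hδη.trans hη1)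
    (fun s => 2 * α s.succ - 1 - a * (γ s.succ / γ 0) + δ * (γ s.succ / γ 0))
    (fun s m => decay (α s.succ) m *
      2 ^ (-(-(a - δ) * (γ s.succ / γ 0)) * (dyadicLevel m : ℝ)))
    (fun s m => by
      refine (mul_le_mul_left (decay_le (hαpos _) (hB _) m) _).trans (le_of_eq ?_)
      rw [mul_assoc, ← two_rpow_add]
      ring_nf)
    (fun s => by
      have h1 := hw s.succ
      have h2 : 0 ≤ 2 * α s.succ - 1 - a * (γ s.succ / γ 0) := by
        rcases lt_or_ge (s.succ : ℕ) μ with h | h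
        · exact (hgap _ h).ge
        · exact (hgap' _ h).le
      nlinarith)
    (fun s hs => by
      have h1 := hw s.succ
      have h2 := hεs s.succ (by simpa using hs)
      nlinarith)
  calc ∑' k : Fin (n + 1) → ℤ, (if R < crossLevel γ k then ∏ s, decay (α s) (k s) else 0)
      = ∑' k : Fin (n + 1) → ℤ,
          (if R - ∑ s : Fin n, γ s.succ / γ 0 * (dyadicLevel (k s.succ) : ℝ) <
            (dyadicLevel (k 0) : ℝ) then decay (α 0) (k 0) else 0) *
          ∏ s : Fin n, decay (α s.succ) (k s.succ) := by
        refine tsum_congr fun k => ?_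
        rw [crossLevel_succ γ (by rw [hγ0]; linarith), Fin.prod_univ_succ, ite_mul, zero_mul]
        simp only [sub_lt_iff_lt_add]
    _ ≤ _ := hcross
    _ ≤ _ := mul_le_mul_right hprod _
    _ = ENNReal.ofReal (3 * B * (2 / η) * 2 ^ (-(a - δ) * R) *
          ((6 * B / ε) ^ n * (1 / δ) ^ (μ - 1))) := by
        rw [two_rpow_eq_ofReal, show (3 : ℝ≥0∞) = ENNReal.ofReal 3 by simp,
          ← ENNReal.ofReal_mul (by positivity), ← ENNReal.ofReal_mul (by positivity),
          ← ENNReal.ofReal_mul (by positivity), ← ENNReal.ofReal_mul (by positivity)]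
    _ = _ := by
        congr 1
        have h1 : -(a - δ) * R = η + -a * R := by
          rw [hδdef]; field_simp; ring
        have h2 : 1 / δ = 1 / η * R := by
          rw [hδdef]; field_simp
        rw [h1, h2, Real.rpow_add two_pos, mul_pow]
        ring

/-- The cardinality of the hyperbolic cross. -/
theorem exists_encard_hypCross_le {d : ℕ} [NeZero d] {μ : ℕ} (hμ : 1 ≤ μ) {γ : Fin d → ℝ}
    (hγ0 : 0 < γ 0) (hγ_eq : ∀ s : Fin d, (s : ℕ) < μ → γ s = γ 0)
    (hγ_lt : ∀ s : Fin d, μ ≤ (s : ℕ) → γ 0 < γ s) :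
    ∃ C : ℝ, 0 < C ∧ ∀ T : ℝ, 1 ≤ T →
      ((hypCross γ T).encard : ℝ≥0∞) ≤ ENNReal.ofReal (C * (2 ^ T * T ^ (μ - 1))) := by
  obtain ⟨n, rfl⟩ : ∃ n, d = n + 1 := Nat.exists_eq_succ_of_ne_zero (NeZero.ne d)
  have hw : ∀ s, 1 ≤ γ s / γ 0 := by
    intro s
    rw [one_le_div hγ0]
    rcases lt_or_ge (s : ℕ) μ with h | h
    · rw [hγ_eq s h]
    · exact (hγ_lt s h).le
  obtain ⟨ε, hε, hε1, hεs⟩ := exists_uniform_pos (fun s : Fin (n + 1) => μ ≤ (s : ℕ))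
    (fun s => γ s / γ 0 - 1)
    (fun s hs => sub_pos.mpr ((one_lt_div hγ0).mpr (hγ_lt s hs)))
  refine ⟨6 * (6 * 1 / ε) ^ n, by positivity, fun T hT => ?_⟩
  -- The same perturbation: `2^{(1+δ)T} = 2 · 2^T` and `1/δ = T`.
  set δ := 1 / T with hδdef
  have hδ : 0 < δ := by positivity
  have hδ1 : δ ≤ 1 := div_le_self zero_le_one hT
  have hcross := tsum_cross_le (fun s : Fin n => γ s.succ / γ 0) (fun _ _ => 1)
    (fun m t => if (dyadicLevel m : ℝ) ≤ t then 1 else 0)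
    3 (1 + δ) T (tsum_dyadicLevel_le_ite hδ.le)
  have hprod := prod_tsum_le (n := n) hμ le_rfl hε hε1 hδ hδ1
    (fun s => (1 + δ) * (γ s.succ / γ 0) - 1)
    (fun s m => 1 * 2 ^ (-((1 + δ) * (γ s.succ / γ 0)) * (dyadicLevel m : ℝ)))
    (fun s m => by
      rw [ENNReal.ofReal_one]
      apply le_of_eq
      ring_nf)
    (fun s => by nlinarith [hw s.succ])
    (fun s hs => by
      have h1 := hw s.succ
      have h2 := hεs s.succ (by simpa using hs)
      nlinarith)
  calc ((hypCross γ T).encard : ℝ≥0∞)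
      = ∑' k : Fin (n + 1) → ℤ, (hypCross γ T).indicator (fun _ => (1 : ℝ≥0∞)) k := by
        rw [← tsum_subtype, ENNReal.tsum_const, ENat.card_coe_set_eq, mul_one]
    _ = ∑' k : Fin (n + 1) → ℤ,
          (if (dyadicLevel (k 0) : ℝ) ≤
            T - ∑ s : Fin n, γ s.succ / γ 0 * (dyadicLevel (k s.succ) : ℝ) then 1 else 0) *
          ∏ s : Fin n, 1 := by
        refine tsum_congr fun k => ?_
        rw [Finset.prod_const_one, mul_one]
        have h := mem_hypCross_iff (γ := γ) (R := T) (k := k)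
        rw [crossLevel_succ γ hγ0.ne', ← le_sub_iff_add_le] at h
        by_cases hk : k ∈ hypCross γ T
        · rw [Set.indicator_of_mem hk, if_pos (h.mp hk)]
        · rw [Set.indicator_of_notMem hk, if_neg (mt h.mpr hk)]
    _ ≤ _ := hcross
    _ ≤ _ := mul_le_mul_right hprod _
    _ = ENNReal.ofReal (3 * 2 ^ ((1 + δ) * T) * ((6 * 1 / ε) ^ n * (1 / δ) ^ (μ - 1))) := by
        rw [two_rpow_eq_ofReal, show (3 : ℝ≥0∞) = ENNReal.ofReal 3 by simp,
          ← ENNReal.ofReal_mul (by positivity), ← ENNReal.ofReal_mul (by positivity)]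
    _ = _ := by
        congr 1
        have h1 : (1 + δ) * T = 1 + T := by
          rw [hδdef]; field_simp; ring
        have h2 : 1 / δ = T := by
          rw [hδdef]; field_simp
        rw [h1, h2, Real.rpow_add two_pos, Real.rpow_one]
        ring

/-! ### Summability of Fourier coefficients and continuity -/

/-- Cauchy–Schwarz, as Hölder's inequality for counting measure; the σ-algebra `⊤` makes
measurability automatic. -/
theorem tsum_sqrt_mul_le {ι : Type*} (a b : ι → ℝ≥0∞) :
    ∑' k, (a k * b k) ^ (1 / 2 : ℝ) ≤ (∑' k, a k) ^ (1 / 2 : ℝ) * (∑' k, b k) ^ (1 / 2 : ℝ) := by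
  let _ : MeasurableSpace ι := ⊤
  have h := ENNReal.lintegral_mul_le_Lp_mul_Lq (Measure.count : Measure ι)
    (p := 2) (q := 2) Real.HolderConjugate.two_two
    (f := fun k => a k ^ (1 / 2 : ℝ)) (g := fun k => b k ^ (1 / 2 : ℝ))
    (measurable_from_top.aemeasurable) (measurable_from_top.aemeasurable)
  simp only [lintegral_count, Pi.mul_apply, ← ENNReal.rpow_mul] at h
  norm_num at h
  simpa only [ENNReal.mul_rpow_of_nonneg _ _ (by norm_num : (0 : ℝ) ≤ 1 / 2)] using h

/-- The Fourier coefficients over a set of frequencies are controlled by the Sobolev norm. -/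
theorem tsum_enorm_mFourierCoeff_le {d : ℕ} (α : Fin d → ℝ) (f : UnitAddTorus (Fin d) → ℂ)
    (p : (Fin d → ℤ) → Prop) [DecidablePred p] :
    ∑' k, (if p k then ‖UnitAddTorus.mFourierCoeff f k‖ₑ else 0) ≤
      hmixNorm α f * (∑' k, if p k then ∏ s, decay (α s) (k s) else 0) ^ (1 / 2 : ℝ) := by
  refine le_trans (le_of_eq (tsum_congr fun k => ?_)) (tsum_sqrt_mul_le _ _)
  split_ifs with h
  · simp only [decay]
    rw [← ENNReal.ofReal_prod_of_nonneg fun s _ => by positivity,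
      ← ENNReal.ofReal_mul (by positivity), mul_assoc, ← Finset.prod_mul_distrib]
    have h1 : ∀ s, (1 + |(k s : ℝ)| ^ 2) ^ (α s) * (1 + |(k s : ℝ)| ^ 2) ^ (-α s) = 1 := by
      intro s
      rw [← Real.rpow_add (by positivity), add_neg_cancel, Real.rpow_zero]
    simp_rw [h1]
    rw [Finset.prod_const_one, mul_one,
      ENNReal.ofReal_rpow_of_nonneg (by positivity) (by norm_num), ← Real.sqrt_eq_rpow,
      Real.sqrt_sq (norm_nonneg _), ofReal_norm]
  · simp

theorem summable_mFourierCoeff {d : ℕ} {α : Fin d → ℝ} (hα : ∀ s, 1 / 2 < α s)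
    {f : UnitAddTorus (Fin d) → ℂ} (hf : hmixNorm α f < ∞) :
    Summable (UnitAddTorus.mFourierCoeff f) := by
  have h := tsum_enorm_mFourierCoeff_le α f (fun _ => True)
  simp only [if_true] at h
  have h2 : ∑' k, ‖UnitAddTorus.mFourierCoeff f k‖ₑ ≠ ∞ := by
    refine ne_top_of_le_ne_top (ENNReal.mul_ne_top hf.ne ?_) h
    exact ENNReal.rpow_ne_top_of_nonneg (by norm_num) (tsum_prod_decay_ne_top hα)
  exact .of_norm (by simpa using ENNReal.summable_toReal h2)

section L2

-- With this choice `volume` on the torus is `torusMeasure d` by definition.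
noncomputable local instance unitAddCircleHaar : MeasureSpace UnitAddCircle := ⟨AddCircle.haarAddCircle⟩

local instance : IsProbabilityMeasure (volume : Measure UnitAddCircle) :=
  inferInstanceAs (IsProbabilityMeasure AddCircle.haarAddCircle)

/-- A square integrable function with summable Fourier coefficients is continuous up to a null
set. -/
theorem exists_continuous_ae_eq {d : ℕ} {f : UnitAddTorus (Fin d) → ℂ}
    (hf : MemLp f 2 (torusMeasure d)) (hs : Summable (UnitAddTorus.mFourierCoeff f)) :
    ∃ g : C(UnitAddTorus (Fin d), ℂ), f =ᵐ[torusMeasure d] g := by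
  change MemLp f 2 (volume : Measure (UnitAddTorus (Fin d))) at hf
  change ∃ g : C(UnitAddTorus (Fin d), ℂ), f =ᵐ[(volume : Measure (UnitAddTorus (Fin d)))] g
  have hc : UnitAddTorus.mFourierCoeff (hf.toLp f) = UnitAddTorus.mFourierCoeff f := by
    funext k
    refine integral_congr_ae ?_
    filter_upwards [hf.coeFn_toLp] with x hx
    rw [hx]
  have h1 := UnitAddTorus.hasSum_mFourier_series_L2 (hf.toLp f)
  rw [hc] at h1
  have h2 : Summable fun k => UnitAddTorus.mFourierCoeff f k •
      (UnitAddTorus.mFourier k : C(UnitAddTorus (Fin d), ℂ)) := by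
    refine .of_norm ?_
    simpa only [norm_smul, UnitAddTorus.mFourier_norm, mul_one] using hs.norm
  refine ⟨∑' k, UnitAddTorus.mFourierCoeff f k • UnitAddTorus.mFourier k, ?_⟩
  have h3 := (ContinuousMap.toLp (E := ℂ) 2 (volume : Measure (UnitAddTorus (Fin d))) ℂ).hasSum
    h2.hasSum
  simp only [map_smul] at h3
  -- The Fourier series converges to `f` in `L₂`, and uniformly, hence in `L₂`, to the continuous
  -- sum; the limits agree.
  have h4 := h1.unique h3
  have h5 := hf.coeFn_toLp
  rw [h4] at h5
  exact h5.symm.trans (ContinuousMap.coeFn_toLp _ _)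

end L2

/-! ### Aliasing and the sampling error -/

theorem mFourier_latticeNode {d : ℕ} (n z : Fin d → ℤ) (M j : ℕ) :
    UnitAddTorus.mFourier n (latticeNode z M j) =
      Complex.exp (2 * Real.pi * Complex.I * ((∑ s, n s * z s : ℤ) / M)) ^ j := by
  rw [← Complex.exp_nat_mul]
  simp only [UnitAddTorus.mFourier, ContinuousMap.coe_mk, latticeNode, fourier_coe_apply]
  rw [← Complex.exp_sum]
  congr 1
  push_cast
  rw [Finset.sum_div, Finset.mul_sum, Finset.mul_sum]
  refine Finset.sum_congr rfl fun s _ => ?_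
  ring

/-- The lattice rule integrates a character exactly unless its frequency aliases to zero. -/
theorem sum_mFourier_latticeNode {d : ℕ} (n z : Fin d → ℤ) {M : ℕ} (hM : 0 < M) :
    (1 / (M : ℂ)) * ∑ j ∈ Finset.range M, UnitAddTorus.mFourier n (latticeNode z M j) =
      if (M : ℤ) ∣ ∑ s, n s * z s then 1 else 0 := by
  have hM' : (M : ℂ) ≠ 0 := by exact_mod_cast hM.ne'
  simp_rw [mFourier_latticeNode]
  set m := ∑ s, n s * z s
  have hone : Complex.exp (2 * Real.pi * Complex.I * ((m : ℤ) / M)) = 1 ↔ (M : ℤ) ∣ m := by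
    rw [Complex.exp_eq_one_iff]
    constructor
    · rintro ⟨q, hq⟩
      refine ⟨q, ?_⟩
      have h2 : (2 * Real.pi * Complex.I : ℂ) ≠ 0 := Complex.two_pi_I_ne_zero
      rw [mul_comm (q : ℂ)] at hq
      have h3 := mul_left_cancel₀ h2 hq
      rw [div_eq_iff hM'] at h3
      rw [mul_comm]
      exact_mod_cast h3
    · rintro ⟨q, hq⟩
      refine ⟨q, ?_⟩
      rw [hq]
      push_cast
      field_simp
  split_ifs with h
  · rw [hone.mpr h]
    simp [hM']
  · have h1 : Complex.exp (2 * Real.pi * Complex.I * ((m : ℤ) / M)) ≠ 1 := mt hone.mp h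
    have h2 : Complex.exp (2 * Real.pi * Complex.I * ((m : ℤ) / M)) ^ M = 1 := by
      rw [← Complex.exp_nat_mul, Complex.exp_eq_one_iff]
      refine ⟨m, ?_⟩
      field_simp
    rw [geom_sum_eq h1, h2]
    simp

/-- The aliasing formula for the lattice rule. -/
theorem hasSum_latticeCoeff {d : ℕ} (z : Fin d → ℤ) {M : ℕ} (hM : 0 < M)
    {f : UnitAddTorus (Fin d) → ℂ} {c : (Fin d → ℤ) → ℂ}
    (hf : ∀ x, HasSum (fun h => c h * UnitAddTorus.mFourier h x) (f x)) (k : Fin d → ℤ) :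
    HasSum (fun h => c h * if (M : ℤ) ∣ ∑ s, (h - k) s * z s then 1 else 0)
      (latticeCoeff z M f k) := by
  have h1 := (hasSum_sum (s := Finset.range M) fun j _ => (hf (latticeNode z M j)).mul_right
    (UnitAddTorus.mFourier (-k) (latticeNode z M j))).mul_left (1 / (M : ℂ))
  refine h1.congr_fun fun h => ?_
  rw [← sum_mFourier_latticeNode _ _ hM, ← mul_assoc, mul_comm (c h), mul_assoc, Finset.mul_sum]
  congr 1
  refine Finset.sum_congr rfl fun j _ => ?_
  rw [sub_eq_add_neg, UnitAddTorus.mFourier_add]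
  ring

/-- The values `k · z` are distinct modulo `M` for distinct `k ∈ I`. -/
def HasDistinctResidues {d : ℕ} (I : Set (Fin d → ℤ)) (z : Fin d → ℤ) (M : ℕ) : Prop :=
  ∀ h ∈ I, ∀ k ∈ I, (M : ℤ) ∣ ∑ s, (h - k) s * z s → h = k

theorem latticeSampling_eq_sum {d : ℕ} {I : Set (Fin d → ℤ)} (hI : I.Finite) (z : Fin d → ℤ)
    (M : ℕ) (f : UnitAddTorus (Fin d) → ℂ) (x : UnitAddTorus (Fin d)) :
    latticeSampling I z M f x =
      ∑ k ∈ hI.toFinset, latticeCoeff z M f k * UnitAddTorus.mFourier k x :=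
  finsum_mem_eq_finite_toFinset_sum _ hI

/-- Sampling replaces each character by the sum of its aliases in `I`. The coefficients `c` are
arbitrary so that both Fourier series and single characters are covered. -/
theorem hasSum_latticeSampling {d : ℕ} {I : Set (Fin d → ℤ)} (hI : I.Finite) (z : Fin d → ℤ)
    {M : ℕ} (hM : 0 < M) {f : UnitAddTorus (Fin d) → ℂ} {c : (Fin d → ℤ) → ℂ}
    (hf : ∀ x, HasSum (fun h => c h * UnitAddTorus.mFourier h x) (f x))
    (x : UnitAddTorus (Fin d)) :
    HasSum (fun h => c h * ∑ k ∈ hI.toFinset,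
      (if (M : ℤ) ∣ ∑ s, (h - k) s * z s then UnitAddTorus.mFourier k x else 0))
      (latticeSampling I z M f x) := by
  rw [latticeSampling_eq_sum hI]
  refine (hasSum_sum fun k _ => (hasSum_latticeCoeff z hM hf k).mul_right
    (UnitAddTorus.mFourier k x)).congr_fun fun h => ?_
  rw [Finset.mul_sum]
  refine Finset.sum_congr rfl fun k _ => ?_
  split_ifs <;> simp

theorem latticeSampling_mFourier {d : ℕ} {I : Set (Fin d → ℤ)} (hI : I.Finite) (z : Fin d → ℤ)
    {M : ℕ} (hM : 0 < M) (h : Fin d → ℤ) (x : UnitAddTorus (Fin d)) :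
    latticeSampling I z M (UnitAddTorus.mFourier h) x = ∑ k ∈ hI.toFinset,
      (if (M : ℤ) ∣ ∑ s, (h - k) s * z s then UnitAddTorus.mFourier k x else 0) := by
  have h1 := hasSum_latticeSampling hI z hM (f := UnitAddTorus.mFourier h) (c := Pi.single h 1)
    (fun x => by
      have := hasSum_single (f := fun h' => (Pi.single h 1 : (Fin d → ℤ) → ℂ) h' *
        UnitAddTorus.mFourier h' x) h (fun h' hh => by simp [Pi.single_eq_of_ne hh])
      simpa using this) x
  refine h1.unique ?_
  have := hasSum_single (f := fun h' => (Pi.single h 1 : (Fin d → ℤ) → ℂ) h' *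
    ∑ k ∈ hI.toFinset,
      (if (M : ℤ) ∣ ∑ s, (h' - k) s * z s then UnitAddTorus.mFourier k x else 0)) h
    (fun h' hh => by simp [Pi.single_eq_of_ne hh])
  simpa only [Pi.single_eq_same, one_mul] using this

theorem sum_aliases_of_mem {d : ℕ} {I : Set (Fin d → ℤ)} (hI : I.Finite)
    {z : Fin d → ℤ} {M : ℕ} (hd : HasDistinctResidues I z M) {h : Fin d → ℤ}
    (hh : h ∈ I) (x : UnitAddTorus (Fin d)) :
    ∑ k ∈ hI.toFinset, (if (M : ℤ) ∣ ∑ s, (h - k) s * z s then UnitAddTorus.mFourier k x else 0) =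
      UnitAddTorus.mFourier h x := by
  rw [Finset.sum_eq_single_of_mem h (by simpa using hh)]
  · simp
  · intro k hk hkh
    rw [if_neg]
    intro hdvd
    exact hkh (hd h hh k (by simpa using hk) hdvd).symm

theorem norm_mFourier_apply {d : ℕ} (k : Fin d → ℤ) (x : UnitAddTorus (Fin d)) :
    ‖UnitAddTorus.mFourier k x‖ ≤ 1 :=
  (ContinuousMap.norm_coe_le_norm _ x).trans UnitAddTorus.mFourier_norm.le

/-- Two aliases of `h` in `I` are aliases of each other, hence equal; at most one term survives,
even for `h ∉ I`. -/
theorem norm_sum_aliases_le {d : ℕ} {I : Set (Fin d → ℤ)} (hI : I.Finite)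
    {z : Fin d → ℤ} {M : ℕ} (hd : HasDistinctResidues I z M) (h : Fin d → ℤ)
    (x : UnitAddTorus (Fin d)) :
    ‖∑ k ∈ hI.toFinset,
      (if (M : ℤ) ∣ ∑ s, (h - k) s * z s then UnitAddTorus.mFourier k x else 0)‖ ≤ 1 := by
  by_cases hex : ∃ k ∈ I, (M : ℤ) ∣ ∑ s, (h - k) s * z s
  · obtain ⟨k, hk, hdvd⟩ := hex
    rw [Finset.sum_eq_single_of_mem k (by simpa using hk), if_pos hdvd]
    · exact norm_mFourier_apply k x
    · intro k' hk' hne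
      rw [if_neg]
      intro hdvd'
      refine hne (hd k' (by simpa using hk') k hk ?_)
      have h1 := dvd_sub hdvd hdvd'
      rw [← Finset.sum_sub_distrib] at h1
      refine h1.trans (dvd_of_eq ?_)
      refine Finset.sum_congr rfl fun s _ => ?_
      simp only [Pi.sub_apply]
      ring
  · rw [Finset.sum_eq_zero, norm_zero]
    · exact zero_le_one
    · intro k hk
      rw [if_neg]
      exact fun hdvd => hex ⟨k, by simpa using hk, hdvd⟩

/-- Reproducing the character of `h ∈ I` at the point `0` says that `h` has exactly one alias in
`I`, namely itself. The converse is linearity. -/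
theorem isReconstructing_iff {d : ℕ} {I : Set (Fin d → ℤ)} (hI : I.Finite) {z : Fin d → ℤ}
    {M : ℕ} : IsReconstructing I z M ↔ 0 < M ∧ HasDistinctResidues I z M := by
  refine and_congr_right fun hM => ⟨fun H h hh k hk hdvd => ?_, fun hd p hp => ?_⟩
  · have h1 := H (UnitAddTorus.mFourier h) (Submodule.subset_span ⟨h, hh, rfl⟩) 0
    rw [latticeSampling_mFourier hI z hM] at h1
    have h0 : ∀ k : Fin d → ℤ, UnitAddTorus.mFourier k (0 : UnitAddTorus (Fin d)) = 1 := by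
      intro k
      simp [UnitAddTorus.mFourier]
    simp only [h0] at h1
    rw [Finset.sum_boole] at h1
    have h2 : (hI.toFinset.filter fun k => (M : ℤ) ∣ ∑ s, (h - k) s * z s).card = 1 := by
      exact_mod_cast h1
    exact Finset.card_le_one.mp h2.le h (by simpa using hh) k (by simpa using ⟨hk, hdvd⟩)
  · induction hp using Submodule.span_induction with
    | mem p hp =>
      obtain ⟨h, hh, rfl⟩ := hp
      intro x
      rw [latticeSampling_mFourier hI z hM, sum_aliases_of_mem hI hd hh]
    | zero =>
      intro x
      simp [latticeSampling, latticeCoeff]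
    | add p q _ _ hp hq =>
      intro x
      rw [ContinuousMap.add_apply, ← hp, ← hq]
      simp only [latticeSampling_eq_sum hI, ← Finset.sum_add_distrib]
      refine Finset.sum_congr rfl fun k _ => ?_
      simp only [latticeCoeff, ContinuousMap.coe_add, Pi.add_apply, add_mul, mul_add,
        Finset.sum_add_distrib]
    | smul a p _ hp =>
      intro x
      rw [ContinuousMap.smul_apply, ← hp]
      simp only [latticeSampling_eq_sum hI, Finset.smul_sum]
      refine Finset.sum_congr rfl fun k _ => ?_
      simp only [latticeCoeff, ContinuousMap.coe_smul, Pi.smul_apply, smul_eq_mul, mul_assoc,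
        ← Finset.mul_sum]
      ring

/-- The sampling error is at most twice the sum of the moduli of the Fourier coefficients outside
of the frequency set. -/
theorem enorm_sub_latticeSampling_le {d : ℕ} {I : Set (Fin d → ℤ)} (hI : I.Finite)
    {z : Fin d → ℤ} {M : ℕ} (hM : 0 < M) (hd : HasDistinctResidues I z M)
    {f : UnitAddTorus (Fin d) → ℂ} {c : (Fin d → ℤ) → ℂ}
    (hf : ∀ x, HasSum (fun h => c h * UnitAddTorus.mFourier h x) (f x))
    (p : (Fin d → ℤ) → Prop) [DecidablePred p] (hp : ∀ k, ¬ p k → k ∈ I)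
    (x : UnitAddTorus (Fin d)) :
    ‖f x - latticeSampling I z M f x‖ₑ ≤ 2 * ∑' h, if p h then ‖c h‖ₑ else 0 := by
  have h1 := (hf x).sub (hasSum_latticeSampling hI z hM hf x)
  rw [← h1.tsum_eq, ← ENNReal.tsum_mul_left]
  refine enorm_tsum_le_tsum_enorm.trans (ENNReal.tsum_le_tsum fun h => ?_)
  rw [← mul_sub, enorm_mul]
  split_ifs with hh
  · rw [mul_comm]
    gcongr
    rw [← ofReal_norm, show (2 : ℝ≥0∞) = ENNReal.ofReal 2 by simp]
    apply ENNReal.ofReal_le_ofReal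
    refine (norm_sub_le _ _).trans ?_
    have h2 := norm_mFourier_apply h x
    have h3 := norm_sum_aliases_le hI hd h x
    linarith
  · rw [sum_aliases_of_mem hI hd (hp h hh)]
    simp

theorem samplingErrorNorm_le {d : ℕ} {α : Fin d → ℝ} (hα : ∀ s, 1 / 2 < α s)
    {I : Set (Fin d → ℤ)} (hI : I.Finite) {z : Fin d → ℤ} {M : ℕ} (hr : IsReconstructing I z M)
    (p : (Fin d → ℤ) → Prop) [DecidablePred p] (hp : ∀ k, ¬ p k → k ∈ I) :
    samplingErrorNorm α I z M ≤
      2 * (∑' k, if p k then ∏ s, decay (α s) (k s) else 0) ^ (1 / 2 : ℝ) := by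
  obtain ⟨hM, hd⟩ := (isReconstructing_iff hI).mp hr
  refine iSup₂_le fun f hf => ?_
  rw [eLpNorm_exponent_top]
  refine eLpNormEssSup_le_of_ae_enorm_bound (Filter.Eventually.of_forall fun x => ?_)
  have hs := summable_mFourierCoeff hα (hf.trans_lt ENNReal.one_lt_top)
  refine (enorm_sub_latticeSampling_le hI hM hd
    (fun x => by
      simpa only [smul_eq_mul] using UnitAddTorus.hasSum_mFourier_series_apply_of_summable hs x)
    p hp x).trans ?_
  gcongr
  refine (tsum_enorm_mFourierCoeff_le α f p).trans ?_
  exact mul_le_of_le_one_left' hf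

/-! ### The component-by-component search -/

section ComponentByComponent

variable {d : ℕ} {I : Set (Fin d → ℤ)}

theorem finite_differenceSet (hI : I.Finite) : (differenceSet I).Finite :=
  hI.image2 _ hI

theorem neg_mem_differenceSet {δ : Fin d → ℤ} (h : δ ∈ differenceSet I) :
    -δ ∈ differenceSet I := by
  obtain ⟨a, ha, b, hb, rfl⟩ := h
  exact ⟨b, hb, a, ha, (neg_sub a b).symm⟩

/-- Since the difference set is symmetric, less than half of it has a positive coordinate `s`. -/
theorem two_mul_card_pos_lt (hI : I.Finite) (hne : I.Nonempty) (s : Fin d) :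
    2 * ((finite_differenceSet hI).toFinset.filter fun δ => 0 < δ s).card <
      (differenceSet I).ncard := by
  classical
  rw [Set.ncard_eq_toFinset_card _ (finite_differenceSet hI)]
  set D := (finite_differenceSet hI).toFinset with hD
  have hmem : ∀ δ, δ ∈ D ↔ δ ∈ differenceSet I := fun δ => by simp [hD]
  set P := D.filter fun δ => 0 < δ s with hP
  have hcard : (P.image fun δ => -δ).card = P.card :=
    Finset.card_image_of_injective _ neg_injective
  have hdisj : Disjoint P (P.image fun δ => -δ) := by
    rw [Finset.disjoint_left]
    intro δ h1 h2
    obtain ⟨ε, hε, rfl⟩ := Finset.mem_image.mp h2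
    have h3 := (Finset.mem_filter.mp h1).2
    have h4 := (Finset.mem_filter.mp hε).2
    simp only [Pi.neg_apply] at h3
    omega
  have h0 : (0 : Fin d → ℤ) ∈ D := by
    obtain ⟨a, ha⟩ := hne
    exact (hmem 0).mpr ⟨a, ha, a, ha, sub_self a⟩
  have hss : P ∪ P.image (fun δ => -δ) ⊂ D := by
    rw [Finset.ssubset_iff_of_subset]
    · refine ⟨0, h0, ?_⟩
      rw [Finset.mem_union, not_or]
      constructor
      · intro h
        simpa using (Finset.mem_filter.mp h).2
      · intro h
        obtain ⟨ε, hε, h1⟩ := Finset.mem_image.mp h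
        have h2 := (Finset.mem_filter.mp hε).2
        rw [neg_eq_zero.mp h1] at h2
        simp at h2
    · refine Finset.union_subset (Finset.filter_subset _ _) ?_
      intro δ h
      obtain ⟨ε, hε, rfl⟩ := Finset.mem_image.mp h
      exact (hmem _).mpr (neg_mem_differenceSet ((hmem _).mp (Finset.mem_filter.mp hε).1))
  have := Finset.card_lt_card hss
  rw [Finset.card_union_of_disjoint hdisj, hcard] at this
  omega

/-- If `P` is smaller than the prime `p`, some residue avoids the zero of each of the linear
forms indexed by `P`. -/
theorem exists_residue_not_dvd {ι : Type*} {p : ℕ} (hp : p.Prime) (P : Finset ι) (hP : P.card < p)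
    (a b : ι → ℤ) (ha : ∀ i ∈ P, 0 < a i ∧ a i < p) :
    ∃ r : ℤ, (0 ≤ r ∧ r < p) ∧ ∀ i ∈ P, ¬ (p : ℤ) ∣ b i + a i * r := by
  classical
  have : Fact p.Prime := ⟨hp⟩
  -- Each `a i` is invertible mod `p`, so each form forbids exactly one residue.
  have h1 : (P.image fun i => -(b i : ZMod p) / (a i : ZMod p)).card <
      (Finset.univ : Finset (ZMod p)).card := by
    rw [Finset.card_univ, ZMod.card]
    exact Finset.card_image_le.trans_lt hP
  obtain ⟨r, -, hr⟩ := Finset.exists_mem_notMem_of_card_lt_card h1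
  refine ⟨r.val, ⟨Int.natCast_nonneg _, by exact_mod_cast ZMod.val_lt r⟩, fun i hi hdvd => hr ?_⟩
  refine Finset.mem_image.mpr ⟨i, hi, ?_⟩
  have ha0 : (a i : ZMod p) ≠ 0 := by
    rw [Ne, ZMod.intCast_zmod_eq_zero_iff_dvd]
    intro h
    have := Int.le_of_dvd (ha i hi).1 h
    have := (ha i hi).2
    omega
  rw [← ZMod.intCast_zmod_eq_zero_iff_dvd] at hdvd
  push_cast at hdvd
  rw [ZMod.natCast_zmod_val] at hdvd
  rw [div_eq_iff ha0]
  linear_combination -hdvd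

/-- Greedy choice: setting `z_s` only has to avoid the residues forbidden by differences with `δ s >
0`, and leaves the earlier partial sums untouched. -/
theorem exists_partial_cbc (hI : I.Finite) (hne : I.Nonempty)
    {p : ℕ} (hp : p.Prime) (hcard : (differenceSet I).ncard ≤ 2 * p)
    (hcoord : ∀ δ ∈ differenceSet I, ∀ s, δ s < p) (m : ℕ) :
    ∃ z : Fin d → ℤ, (∀ s, 0 ≤ z s ∧ z s < p) ∧ ∀ s : Fin d, (s : ℕ) < m →
      ∀ δ ∈ differenceSet I, 0 < δ s → ¬ (p : ℤ) ∣ ∑ t ∈ Finset.Iic s, δ t * z t := by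
  classical
  induction m with
  | zero => exact ⟨0, fun s => ⟨le_rfl, by simpa using hp.pos⟩, fun s hs => absurd hs (by simp)⟩
  | succ m ih =>
    obtain ⟨z, hz, hstep⟩ := ih
    by_cases hm : m < d
    · set s : Fin d := ⟨m, hm⟩ with hs
      have hlt := two_mul_card_pos_lt hI hne s
      obtain ⟨r, hr, hr'⟩ := exists_residue_not_dvd hp
        ((finite_differenceSet hI).toFinset.filter fun δ => 0 < δ s) (by omega)
        (fun δ => δ s) (fun δ => ∑ t ∈ Finset.Iio s, δ t * z t)
        (fun δ hδ => by
          rw [Finset.mem_filter, Set.Finite.mem_toFinset] at hδ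
          exact ⟨hδ.2, hcoord δ hδ.1 s⟩)
      refine ⟨Function.update z s r, fun t => ?_, fun t ht δ hδ hpos => ?_⟩
      · rcases eq_or_ne t s with rfl | h
        · simpa using hr
        · simpa [Function.update_of_ne h] using hz t
      · rcases eq_or_ne t s with rfl | h
        · have := hr' δ (by simpa using ⟨hδ, hpos⟩)
          rw [← Finset.Iio_insert, Finset.sum_insert (by simp), Function.update_self,
            add_comm]
          have hsum : ∑ x ∈ Finset.Iio s, δ x * Function.update z s r x =
              ∑ x ∈ Finset.Iio s, δ x * z x := Finset.sum_congr rfl fun x hx => by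
            rw [Function.update_of_ne (Finset.mem_Iio.mp hx).ne]
          rwa [hsum]
        · have hts : (t : ℕ) < m := by
            have : (t : ℕ) ≠ m := fun h' => h (Fin.ext h')
            omega
          have hsum : ∑ x ∈ Finset.Iic t, δ x * Function.update z s r x =
              ∑ x ∈ Finset.Iic t, δ x * z x := by
            refine Finset.sum_congr rfl fun x hx => ?_
            rw [Function.update_of_ne]
            have : x ≤ t := Finset.mem_Iic.mp hx
            rintro rfl
            have : (s : ℕ) ≤ t := this
            simp only [hs] at this
            omega
          rw [hsum]
          exact hstep t hts δ hδ hpos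
    · exact ⟨z, hz, fun s hs => hstep s (by omega)⟩

theorem exists_isCBCVector (hI : I.Finite) (hne : I.Nonempty)
    {p : ℕ} (hp : p.Prime) (hcard : (differenceSet I).ncard ≤ 2 * p)
    (hcoord : ∀ δ ∈ differenceSet I, ∀ s, δ s < p) :
    ∃ z : Fin d → ℤ, IsCBCVector I z p := by
  classical
  obtain ⟨z, hz, hstep⟩ := exists_partial_cbc hI hne hp hcard hcoord d
  refine ⟨z, hz, fun s k hk k' hk' hmod => ?_⟩
  by_contra! hcon
  obtain ⟨t₀, ht₀, hne₀⟩ := hcon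
  -- At the last differing coordinate `t ≤ s` the congruence truncates to `Iic t`, and one of `±(k -
  -- k')` was excluded at stage `t`.
  obtain ⟨t, ht, hmax⟩ := Finset.exists_max_image
    ((Finset.Iic s).filter fun t => k t ≠ k' t) id ⟨t₀, by simpa using ⟨ht₀, hne₀⟩⟩
  rw [Finset.mem_filter, Finset.mem_Iic] at ht
  have hdvd : (p : ℤ) ∣ ∑ u ∈ Finset.Iic t, (k' - k) u * z u := by
    have h1 := Int.modEq_iff_dvd.mp hmod
    rw [← Finset.sum_sub_distrib] at h1
    convert h1 using 1
    rw [← Finset.sum_subset (Finset.Iic_subset_Iic.mpr ht.1)]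
    · refine Finset.sum_congr rfl fun u _ => ?_
      simp only [Pi.sub_apply]
      ring
    · intro u hu hut
      have : k u = k' u := by
        by_contra h
        exact hut (Finset.mem_Iic.mpr (hmax u (Finset.mem_filter.mpr ⟨hu, h⟩)))
      rw [this, sub_self]
  rcases lt_or_gt_of_ne ht.2 with h | h
  · exact hstep t t.2 (k' - k) ⟨k', hk', k, hk, rfl⟩ (by simpa using h) hdvd
  · refine hstep t t.2 (k - k') ⟨k, hk, k', hk', rfl⟩ (by simpa using h) ?_
    rw [← neg_sub k' k]
    simpa only [Pi.neg_apply, neg_mul, Finset.sum_neg_distrib, dvd_neg] using hdvd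

end ComponentByComponent

/-! ### Differences in the cross and the lattice size -/

section HyperbolicCross

variable {d : ℕ} [NeZero d] {γ : Fin d → ℝ} {R : ℝ}

theorem crossLevel_single (s : Fin d) (m : ℤ) :
    crossLevel γ (Pi.single s m) = γ s / γ 0 * dyadicLevel m := by
  rw [crossLevel, Finset.sum_eq_single s]
  · rw [Pi.single_eq_same]; ring
  · intro t _ ht
    rw [Pi.single_eq_of_ne ht]
    simp [dyadicLevel]
  · simp

theorem single_mem_hypCross (hγ : ∀ s, 0 < γ s) {h : Fin d → ℤ} (hh : h ∈ hypCross γ R) (s : Fin d)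
    {m : ℤ} (hm : dyadicLevel m ≤ dyadicLevel (h s)) : Pi.single s m ∈ hypCross γ R := by
  rw [mem_hypCross_iff] at hh ⊢
  refine le_trans ?_ hh
  rw [crossLevel_single, crossLevel, Finset.mul_sum]
  have h1 := Finset.single_le_sum (f := fun t => 1 / γ 0 * (γ t * (dyadicLevel (h t) : ℝ)))
    (fun t _ => mul_nonneg (one_div_pos.mpr (hγ 0)).le
      (mul_nonneg (hγ t).le (Nat.cast_nonneg _))) (Finset.mem_univ s)
  refine le_trans ?_ h1
  have h2 : (dyadicLevel m : ℝ) ≤ dyadicLevel (h s) := Nat.cast_le.mpr hm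
  have h3 : 0 ≤ γ s / γ 0 := (div_pos (hγ s) (hγ 0)).le
  calc γ s / γ 0 * (dyadicLevel m : ℝ) ≤ γ s / γ 0 * (dyadicLevel (h s) : ℝ) := by gcongr
    _ = _ := by ring

theorem single_mem_hypCross_zero (hR : 0 ≤ R) (s : Fin d) {m : ℤ} (hm : m.natAbs ≤ 1) :
    Pi.single s m ∈ hypCross γ R := by
  rw [mem_hypCross_iff, crossLevel_single]
  have : dyadicLevel m = 0 := Nat.le_zero.mp (dyadicLevel_le_iff.mpr (by simpa using hm))
  simpa [this] using hR

/-- Axis `s` of the difference set contains the whole segment `[-2x, 2x]` with `x = 2 ^ dyadicLevel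
(h s)`. This keeps coordinates of differences below the prime of the search. -/
theorem two_mul_lt_ncard_of_mem (hγ : ∀ s, 0 < γ s) {h : Fin d → ℤ} (hh : h ∈ hypCross γ R)
    (s : Fin d) :
    2 * (2 * 2 ^ dyadicLevel (h s)) < (differenceSet (hypCross γ R)).ncard := by
  have hinj : Function.Injective fun m : ℤ => (Pi.single s m : Fin d → ℤ) :=
    Pi.single_injective (M := fun _ : Fin d => ℤ) s
  set x : ℕ := 2 ^ dyadicLevel (h s) with hx
  have h1 : (fun m : ℤ => (Pi.single s m : Fin d → ℤ)) '' (Finset.Icc (-(2 * x : ℕ) : ℤ) (2 * x : ℕ) :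
      Set ℤ) ⊆ differenceSet (hypCross γ R) := by
    rintro _ ⟨m, hm, rfl⟩
    rw [Finset.coe_Icc, Set.mem_Icc] at hm
    refine ⟨Pi.single s (m / 2), single_mem_hypCross hγ hh s ?_,
      Pi.single s (m / 2 - m), single_mem_hypCross hγ hh s ?_, ?_⟩
    · rw [dyadicLevel_le_iff, ← hx]; omega
    · rw [dyadicLevel_le_iff, ← hx]; omega
    · dsimp only
      rw [← Pi.single_sub]
      congr 1
      ring
  have h2 := Set.ncard_le_ncard h1 (finite_differenceSet (finite_hypCross γ hγ R))
  rw [Set.ncard_image_of_injective _ hinj, Set.ncard_coe_finset, Int.card_Icc] at h2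
  omega

theorem exists_prime_isCBCVector (hγ : ∀ s, 0 < γ s) (hR : 0 ≤ R) :
    ∃ (z : Fin d → ℤ) (M : ℕ), M.Prime ∧ M ≤ (differenceSet (hypCross γ R)).ncard ∧
      IsCBCVector (hypCross γ R) z M := by
  set N := (differenceSet (hypCross γ R)).ncard with hN
  have h1 := two_mul_lt_ncard_of_mem hγ (single_mem_hypCross_zero (γ := γ) hR 0 (m := 1) le_rfl) 0
  have h1' : 1 ≤ 2 ^ dyadicLevel ((Pi.single 0 1 : Fin d → ℤ) 0) := Nat.one_le_two_pow
  -- Bertrand's postulate; the floor still gives `N ≤ 2p` and `p < N`.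
  obtain ⟨p, hp, hlt, hle⟩ := Nat.exists_prime_lt_and_le_two_mul ((N - 1) / 2) (by omega)
  obtain ⟨z, hz⟩ := exists_isCBCVector (I := hypCross γ R) (finite_hypCross γ hγ R)
    ⟨_, single_mem_hypCross_zero hR 0 (m := 1) le_rfl⟩ hp (by omega) (by
      rintro _ ⟨h, hh, h', hh', rfl⟩ s
      have h2 := two_mul_lt_ncard_of_mem hγ hh s
      have h3 := two_mul_lt_ncard_of_mem hγ hh' s
      have h4 := dyadicLevel_le_iff.mp (le_refl (dyadicLevel (h s)))
      have h5 := dyadicLevel_le_iff.mp (le_refl (dyadicLevel (h' s)))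
      simp only [Pi.sub_apply]
      generalize 2 ^ dyadicLevel (h s) = x at *
      generalize 2 ^ dyadicLevel (h' s) = y at *
      omega)
  exact ⟨z, p, hp, by omega, hz⟩

theorem dyadicLevel_sub_le (a b : ℤ) :
    dyadicLevel (a - b) ≤ dyadicLevel a + dyadicLevel b + 1 := by
  rw [dyadicLevel_le_iff]
  have h1 := dyadicLevel_le_iff.mp (le_refl (dyadicLevel a))
  have h2 := dyadicLevel_le_iff.mp (le_refl (dyadicLevel b))
  have h3 : 1 ≤ 2 ^ dyadicLevel a := Nat.one_le_two_pow
  have h4 : 1 ≤ 2 ^ dyadicLevel b := Nat.one_le_two_pow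
  rw [pow_succ, pow_add]
  have h5 : (a - b).natAbs ≤ a.natAbs + b.natAbs := Int.natAbs_sub_le a b
  nlinarith

/-- Levels are subadditive under subtraction up to `1`, and the extra `1` in each coordinate costs
its weight. -/
theorem differenceSet_hypCross_subset (hγ : ∀ s, 0 < γ s) :
    differenceSet (hypCross γ R) ⊆ hypCross γ (2 * R + ∑ s, γ s / γ 0) := by
  rintro _ ⟨h, hh, h', hh', rfl⟩
  rw [mem_hypCross_iff] at hh hh' ⊢
  have : crossLevel γ (h - h') ≤ crossLevel γ h + crossLevel γ h' + ∑ s, γ s / γ 0 := by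
    simp only [crossLevel, Finset.mul_sum, ← Finset.sum_add_distrib]
    refine Finset.sum_le_sum fun s _ => ?_
    have h1 : (dyadicLevel (h s - h' s) : ℝ) ≤ dyadicLevel (h s) + dyadicLevel (h' s) + 1 := by
      exact_mod_cast dyadicLevel_sub_le (h s) (h' s)
    have h3 : 0 ≤ γ s / γ 0 := (div_pos (hγ s) (hγ 0)).le
    calc 1 / γ 0 * (γ s * (dyadicLevel ((h - h') s) : ℝ))
        = γ s / γ 0 * (dyadicLevel (h s - h' s) : ℝ) := by rw [Pi.sub_apply]; ring
      _ ≤ γ s / γ 0 * (dyadicLevel (h s) + dyadicLevel (h' s) + 1) := by gcongr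
      _ = _ := by ring
  linarith

/-- The cardinality of the difference set of the hyperbolic cross. -/
theorem exists_ncard_differenceSet_le {μ : ℕ} (hμ : 1 ≤ μ) (hγ0 : 0 < γ 0)
    (hγ_eq : ∀ s : Fin d, (s : ℕ) < μ → γ s = γ 0)
    (hγ_lt : ∀ s : Fin d, μ ≤ (s : ℕ) → γ 0 < γ s) :
    ∃ C : ℝ, 0 < C ∧ ∀ R : ℝ, 1 ≤ R →
      ((differenceSet (hypCross γ R)).ncard : ℝ) ≤ C * (2 ^ (2 * R) * R ^ (μ - 1)) := by
  have hγ : ∀ s, 0 < γ s := fun s => by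
    rcases lt_or_ge (s : ℕ) μ with h | h
    · rw [hγ_eq s h]; exact hγ0
    · exact hγ0.trans (hγ_lt s h)
  obtain ⟨C, hC, h⟩ := exists_encard_hypCross_le hμ hγ0 hγ_eq hγ_lt
  set W := ∑ s, γ s / γ 0 with hWdef
  have hW : 0 ≤ W := Finset.sum_nonneg fun s _ => (div_pos (hγ s) hγ0).le
  refine ⟨C * 2 ^ W * (2 + W) ^ (μ - 1), by positivity, fun R hR => ?_⟩
  have hfin := finite_hypCross γ hγ (2 * R + W)
  have h1 := h (2 * R + W) (by linarith)
  rw [← hfin.cast_ncard_eq] at h1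
  have h2 : ((hypCross γ (2 * R + W)).ncard : ℝ) ≤
      C * (2 ^ (2 * R + W) * (2 * R + W) ^ (μ - 1)) := by
    have h3 : ENNReal.ofReal ((hypCross γ (2 * R + W)).ncard : ℝ) ≤
        ENNReal.ofReal (C * (2 ^ (2 * R + W) * (2 * R + W) ^ (μ - 1))) := by
      rw [ENNReal.ofReal_natCast]
      simpa using h1
    exact (ENNReal.ofReal_le_ofReal_iff (by positivity)).mp h3
  calc ((differenceSet (hypCross γ R)).ncard : ℝ)
      ≤ (hypCross γ (2 * R + W)).ncard :=
        Nat.cast_le.mpr (Set.ncard_le_ncard (differenceSet_hypCross_subset hγ) hfin)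
    _ ≤ C * (2 ^ (2 * R + W) * (2 * R + W) ^ (μ - 1)) := h2
    _ ≤ C * (2 ^ (2 * R + W) * ((2 + W) * R) ^ (μ - 1)) := by
        gcongr
        nlinarith
    _ = _ := by
        rw [Real.rpow_add two_pos, mul_pow]
        ring

theorem IsCBCVector.hasDistinctResidues {I : Set (Fin d → ℤ)} {z : Fin d → ℤ} {M : ℕ}
    (hz : IsCBCVector I z M) : 0 < M ∧ HasDistinctResidues I z M := by
  have h0 := hz.range 0
  refine ⟨by omega, fun h hh k hk hdvd => ?_⟩
  obtain ⟨n, rfl⟩ : ∃ n, d = n + 1 := Nat.exists_eq_succ_of_ne_zero (NeZero.ne d)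
  funext t
  refine hz.step (Fin.last n) h hh k hk ?_ t (Fin.le_last t)
  have h1 : Finset.Iic (Fin.last n) = Finset.univ := by
    ext t; simp [Fin.le_last]
  rw [h1, Int.modEq_comm, Int.modEq_iff_dvd, ← Finset.sum_sub_distrib]
  simpa only [Pi.sub_apply, sub_mul] using hdvd

/-- The first axis of the cross holds `2 · 2^⌊R⌋ + 1` points, which need distinct residues. -/
theorem HasDistinctResidues.two_rpow_le (hγ0 : γ 0 ≠ 0) (hR : 0 ≤ R) {z : Fin d → ℤ} {M : ℕ}
    (hM : 0 < M) (hd : HasDistinctResidues (hypCross γ R) z M) : (2 : ℝ) ^ R ≤ M := by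
  set x : ℕ := 2 ^ ⌊R⌋₊ with hx
  have hmem : ∀ m ∈ Finset.Icc (-(x : ℕ) : ℤ) (x : ℕ), Pi.single 0 m ∈ hypCross γ R := by
    intro m hm
    rw [Finset.mem_Icc] at hm
    rw [mem_hypCross_iff, crossLevel_single, div_self hγ0, one_mul]
    have h1 : dyadicLevel m ≤ ⌊R⌋₊ := dyadicLevel_le_iff.mpr (by omega)
    exact (Nat.le_floor_iff hR).mp h1
  have hcard : (Finset.Icc (-(x : ℕ) : ℤ) (x : ℕ)).card ≤ (Finset.Ico (0 : ℤ) M).card := by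
    refine Finset.card_le_card_of_injOn
      (fun m => (∑ s, (Pi.single 0 m : Fin d → ℤ) s * z s) % M) ?_ ?_
    · intro m _
      rw [Finset.coe_Ico, Set.mem_Ico]
      have hM' : (0 : ℤ) < M := by exact_mod_cast hM
      exact ⟨Int.emod_nonneg _ hM'.ne', Int.emod_lt_of_pos _ hM'⟩
    · intro m hm m' hm' heq
      refine Pi.single_injective (M := fun _ : Fin d => ℤ) 0
        (hd _ (hmem m hm) _ (hmem m' hm') ?_)
      have h1 := Int.modEq_iff_dvd.mp (Int.ModEq.symm heq)
      rw [← Finset.sum_sub_distrib] at h1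
      simpa only [Pi.sub_apply, sub_mul] using h1
  rw [Int.card_Icc, Int.card_Ico] at hcard
  have h2 : 2 * x ≤ M := by omega
  calc (2 : ℝ) ^ R ≤ 2 ^ ((⌊R⌋₊ : ℝ) + 1) :=
        Real.rpow_le_rpow_of_exponent_le (by norm_num) (Nat.lt_floor_add_one R).le
    _ = ((2 * x : ℕ) : ℝ) := by
        rw [Real.rpow_add two_pos, Real.rpow_natCast, Real.rpow_one, hx]
        push_cast
        ring
    _ ≤ M := Nat.cast_le.mpr h2

end HyperbolicCross

/-! ### Rates in terms of `R` and of `M` -/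

/-- Comparison of the bounds in terms of the refinement and of the lattice size. -/
theorem rate_le_of_size_le {b q K R M : ℝ} (hb : 0 ≤ b) (hq : 0 ≤ q) (hK : 0 < K) (hR : 0 < R)
    (hM : (2 : ℝ) ^ R ≤ M) (hM' : M ≤ K * (2 ^ (2 * R) * R ^ q)) :
    (2 : ℝ) ^ (-b * R) * R ^ (q / 2) ≤
      K ^ (b / 2) * Real.log 2 ^ (-(q * (b / 2 + 1 / 2))) *
        (M ^ (-b / 2) * Real.log M ^ (q * (b / 2 + 1 / 2))) := by
  have hM0 : 0 < M := lt_of_lt_of_le (by positivity) hM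
  have hl2 : 0 < Real.log 2 := Real.log_pos (by norm_num)
  have hlog : R * Real.log 2 ≤ Real.log M := by
    rw [← Real.log_rpow two_pos]
    exact Real.log_le_log (by positivity) hM
  -- The upper bound on `M` loses `R^{-qb/2}`; the logarithmic power `q(b/2 + 1/2)` restores it and
  -- leaves `R^{q/2}`.
  have h1 : K ^ (-(b / 2)) * (2 ^ (-b * R) * R ^ (-(q * (b / 2)))) ≤ M ^ (-b / 2) := by
    calc _ = (K * (2 ^ (2 * R) * R ^ q)) ^ (-b / 2) := by
          rw [Real.mul_rpow hK.le (by positivity), Real.mul_rpow (by positivity) (by positivity),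
            ← Real.rpow_mul two_pos.le, ← Real.rpow_mul hR.le]
          ring_nf
      _ ≤ _ := Real.rpow_le_rpow_of_nonpos hM0 hM' (by linarith)
  have h2 : R ^ (q * (b / 2 + 1 / 2)) * Real.log 2 ^ (q * (b / 2 + 1 / 2)) ≤
      Real.log M ^ (q * (b / 2 + 1 / 2)) := by
    rw [← Real.mul_rpow hR.le hl2.le]
    exact Real.rpow_le_rpow (by positivity) hlog (by positivity)
  calc (2 : ℝ) ^ (-b * R) * R ^ (q / 2)
      = K ^ (b / 2) * Real.log 2 ^ (-(q * (b / 2 + 1 / 2))) *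
          ((K ^ (-(b / 2)) * (2 ^ (-b * R) * R ^ (-(q * (b / 2))))) *
          (R ^ (q * (b / 2 + 1 / 2)) * Real.log 2 ^ (q * (b / 2 + 1 / 2)))) := by
        have e1 : K ^ (b / 2) * K ^ (-(b / 2)) = 1 := by
          rw [← Real.rpow_add hK, add_neg_cancel, Real.rpow_zero]
        have e2 : Real.log 2 ^ (-(q * (b / 2 + 1 / 2))) * Real.log 2 ^ (q * (b / 2 + 1 / 2)) = 1 := by
          rw [← Real.rpow_add hl2, neg_add_cancel, Real.rpow_zero]
        have e3 : R ^ (-(q * (b / 2))) * R ^ (q * (b / 2 + 1 / 2)) = R ^ (q / 2) := by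
          rw [← Real.rpow_add hR]
          ring_nf
        rw [← e3]
        linear_combination -((2 : ℝ) ^ (-b * R) * R ^ (-(q * (b / 2))) *
          R ^ (q * (b / 2 + 1 / 2))) * (e1 + K ^ (b / 2) * K ^ (-(b / 2)) * e2)
    _ ≤ _ := by gcongr

/-- The bound in terms of the refinement, for every reconstructing lattice. -/
theorem exists_samplingErrorNorm_le {d : ℕ} [NeZero d] {μ : ℕ} (hμ : 1 ≤ μ) {α γ : Fin d → ℝ}
    (hα : 1 / 2 < α 0) (hα_mono : Monotone α)
    (hα_eq : ∀ s : Fin d, (s : ℕ) < μ → α s = α 0)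
    (hγ_eq : ∀ s : Fin d, (s : ℕ) < μ → γ s = α s)
    (hγ_lt : ∀ s : Fin d, μ ≤ (s : ℕ) → α 0 < γ s ∧ γ s < α s)
    (hα' : ∀ s, 1 / 2 < α s) (hγ : ∀ s, 0 < γ s) :
    ∃ C : ℝ, 0 < C ∧ ∀ R : ℝ, 1 ≤ R → ∀ (z : Fin d → ℤ) (M : ℕ),
      IsReconstructing (hypCross γ R) z M →
        samplingErrorNorm α (hypCross γ R) z M ≤
          ENNReal.ofReal (C * ((2 : ℝ) ^ (-(α 0 - 1 / 2) * R) * R ^ (((μ : ℝ) - 1) / 2))) := by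
  obtain ⟨C, hC, h⟩ := exists_tsum_decay_tail_le hμ hα hα_mono hα_eq hγ_eq hγ_lt
  refine ⟨2 * C ^ (1 / 2 : ℝ), by positivity, fun R hR z M hr => ?_⟩
  have hR0 : 0 ≤ R := by linarith
  refine (samplingErrorNorm_le hα' (finite_hypCross γ hγ R) hr (fun k => R < crossLevel γ k)
    fun k hk => mem_hypCross_iff.mpr (not_lt.mp hk)).trans ?_
  calc _ ≤ 2 * (ENNReal.ofReal (C * (2 ^ (-(2 * α 0 - 1) * R) * R ^ (μ - 1)))) ^ (1 / 2 : ℝ) := by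
        gcongr
        exact h R hR
    _ = ENNReal.ofReal (2 * (C * (2 ^ (-(2 * α 0 - 1) * R) * R ^ (μ - 1))) ^ (1 / 2 : ℝ)) := by
        rw [ENNReal.ofReal_rpow_of_nonneg (by positivity) (by norm_num),
          ENNReal.ofReal_mul two_pos.le]
        simp
    _ = _ := by
        congr 1
        have h1 : R ^ (μ - 1) = R ^ ((μ : ℝ) - 1) := by
          rw [← Real.rpow_natCast, Nat.cast_sub hμ, Nat.cast_one]
        rw [h1, Real.mul_rpow hC.le (by positivity), Real.mul_rpow (by positivity) (by positivity),
          ← Real.rpow_mul two_pos.le, ← Real.rpow_mul hR0, mul_assoc]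
        ring_nf

end LatticeSampling

theorem mainTheorem11 {d : ℕ} [NeZero d] (μ : ℕ) (hμ : 1 ≤ μ) (hμd : μ ≤ d)
    (α γ : Fin d → ℝ)
    (hα : 1 / 2 < α 0) (hα_mono : Monotone α)
    (hα_eq : ∀ s : Fin d, (s : ℕ) < μ → α s = α 0)
    (hα_lt : ∀ s : Fin d, μ ≤ (s : ℕ) → α 0 < α s)
    (hγ_eq : ∀ s : Fin d, (s : ℕ) < μ → γ s = α s)
    (hγ_lt : ∀ s : Fin d, μ ≤ (s : ℕ) → α 0 < γ s ∧ γ s < α s) :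
    -- every element of the Sobolev space has a continuous representative
    (∀ f : UnitAddTorus (Fin d) → ℂ, MemLp f 2 (LatticeSampling.torusMeasure d) →
      LatticeSampling.hmixNorm α f < ∞ →
        ∃ g : C(UnitAddTorus (Fin d), ℂ), f =ᵐ[LatticeSampling.torusMeasure d] g) ∧
    -- the bound in terms of `R`, for every reconstructing rank-1 lattice
    (∃ C : ℝ, 0 < C ∧ ∀ R : ℝ, 1 ≤ R → ∀ (z : Fin d → ℤ) (M : ℕ),
      LatticeSampling.IsReconstructing (LatticeSampling.hypCross γ R) z M →
        LatticeSampling.samplingErrorNorm α (LatticeSampling.hypCross γ R) z M ≤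
          ENNReal.ofReal (C * ((2 : ℝ) ^ (-(α 0 - 1 / 2) * R) * R ^ (((μ : ℝ) - 1) / 2)))) ∧
    -- the component-by-component search succeeds for some prime `M` at most `|D(H_R)|`
    (∀ R : ℝ, 1 ≤ R → ∃ (z : Fin d → ℤ) (M : ℕ), M.Prime ∧
      M ≤ (LatticeSampling.differenceSet (LatticeSampling.hypCross γ R)).ncard ∧
      LatticeSampling.IsCBCVector (LatticeSampling.hypCross γ R) z M) ∧
    -- the bounds for lattices constructed component by component, with size of that order
    (∀ κ : ℝ, ∃ C : ℝ, 0 < C ∧ ∀ R : ℝ, 1 ≤ R → ∀ (z : Fin d → ℤ) (M : ℕ),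
      LatticeSampling.IsCBCVector (LatticeSampling.hypCross γ R) z M →
      (M : ℝ) ≤ κ * (LatticeSampling.differenceSet (LatticeSampling.hypCross γ R)).ncard →
        LatticeSampling.IsReconstructing (LatticeSampling.hypCross γ R) z M ∧
        (2 : ℝ) ^ (-(α 0 - 1 / 2) * R) * R ^ (((μ : ℝ) - 1) / 2) ≤
          C * ((M : ℝ) ^ (-(α 0 - 1 / 2) / 2) *
            Real.log M ^ (((μ : ℝ) - 1) * (α 0 / 2 + 1 / 4))) ∧
        LatticeSampling.samplingErrorNorm α (LatticeSampling.hypCross γ R) z M ≤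
          ENNReal.ofReal (C * ((M : ℝ) ^ (-(α 0 - 1 / 2) / 2) *
            Real.log M ^ (((μ : ℝ) - 1) * (α 0 / 2 + 1 / 4))))) := by
  have hγ0 : γ 0 = α 0 := hγ_eq 0 hμ
  have hα' : ∀ s, 1 / 2 < α s := fun s => hα.trans_le (hα_mono (Fin.le_def.mpr (by simp)))
  have hγ : ∀ s, 0 < γ s := fun s => by
    rcases lt_or_ge (s : ℕ) μ with h | h
    · rw [hγ_eq s h]; linarith [hα' s]
    · linarith [(hγ_lt s h).1]
  have hμ' : (1 : ℝ) ≤ μ := by exact_mod_cast hμ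
  obtain ⟨C, hC, hbound⟩ := LatticeSampling.exists_samplingErrorNorm_le hμ hα hα_mono hα_eq hγ_eq
    hγ_lt hα' hγ
  refine ⟨fun f hf hfα => LatticeSampling.exists_continuous_ae_eq hf
    (LatticeSampling.summable_mFourierCoeff hα' hfα), ⟨C, hC, hbound⟩,
    fun R hR => LatticeSampling.exists_prime_isCBCVector hγ (by linarith), fun κ => ?_⟩
  obtain ⟨D, hD, hcard⟩ := LatticeSampling.exists_ncard_differenceSet_le (γ := γ) hμ (hγ 0)
    (fun s hs => by rw [hγ_eq s hs, hα_eq s hs, hγ0])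
    (fun s hs => by rw [hγ0]; exact (hγ_lt s hs).1)
  -- The maximum keeps `K` positive for every real `κ`.
  set K := max κ 1 * D with hKdef
  have hK : 0 < K := mul_pos (lt_of_lt_of_le one_pos (le_max_right _ _)) hD
  set e := ((μ : ℝ) - 1) * ((α 0 - 1 / 2) / 2 + 1 / 2) with he
  have hl2 : 0 < Real.log 2 := Real.log_pos (by norm_num)
  set A := K ^ ((α 0 - 1 / 2) / 2) * Real.log 2 ^ (-e) with hA
  have hA0 : 0 < A := by positivity
  -- One constant for both bounds: the comparison of rates needs `A`, the error bound `C * A`.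
  refine ⟨(C + 1) * A, by positivity, fun R hR z M hz hMκ => ?_⟩
  obtain ⟨hM, hd⟩ := hz.hasDistinctResidues
  have hrec := (LatticeSampling.isReconstructing_iff
    (LatticeSampling.finite_hypCross γ hγ R)).mpr ⟨hM, hd⟩
  have hM2 := hd.two_rpow_le (hγ 0).ne' (by linarith) hM
  have hM3 : (M : ℝ) ≤ K * (2 ^ (2 * R) * R ^ ((μ : ℝ) - 1)) := by
    have h1 := hcard R hR
    rw [← Real.rpow_natCast, Nat.cast_sub hμ, Nat.cast_one] at h1
    calc (M : ℝ) ≤ κ * (LatticeSampling.differenceSet (LatticeSampling.hypCross γ R)).ncard := hMκ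
      _ ≤ max κ 1 * (LatticeSampling.differenceSet (LatticeSampling.hypCross γ R)).ncard := by
          gcongr
          exact le_max_left _ _
      _ ≤ max κ 1 * (D * (2 ^ (2 * R) * R ^ ((μ : ℝ) - 1))) := by gcongr
      _ = _ := by rw [hKdef]; ring
  have hrate := LatticeSampling.rate_le_of_size_le (b := α 0 - 1 / 2) (q := (μ : ℝ) - 1)
    (by linarith) (by linarith) hK (by linarith) hM2 hM3
  have hexp : α 0 / 2 + 1 / 4 = (α 0 - 1 / 2) / 2 + 1 / 2 := by ring
  rw [hexp, ← he]
  rw [← he, ← hA] at hrate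
  have hlogM : 0 ≤ Real.log M := Real.log_natCast_nonneg M
  set X := (M : ℝ) ^ (-(α 0 - 1 / 2) / 2) * Real.log M ^ e
  have hX : 0 ≤ X := by positivity
  refine ⟨hrec, ?_, (hbound R hR z M hrec).trans (ENNReal.ofReal_le_ofReal ?_)⟩
  · nlinarith [mul_nonneg hC.le (mul_nonneg hA0.le hX)]
  · nlinarith [mul_le_mul_of_nonneg_left hrate hC.le, mul_nonneg hA0.le hX]
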